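/- Let $\Pi$ be a finite projective plane of order $10$, that is, a finite set of points and a finite set of lines such that every line contains exactly $11$ points, every point lies on exactly $11$ lines, any two distinct points lie on a unique common line, and any two distinct lines meet in a unique point. Let $M$ be the incidence matrix of $\Pi$: its rows are indexed by the lines and its columns by the points, with $M_{\ell,p}=1$ if $p$ lies on $\ell$ and $M_{\ell,p}=0$ otherwise. Let $C$ be the binary code of $\Pi$, the subspace over the field $\mathbb{F}_2$ spanned by the rows of $M$, and let the weight of a codeword be the number of its non-zero coordinates. Then $C$ contains no codeword of weight $15$; that is, the number $A_{15}$ of codewords of weight $15$ in $C$ is $0$. -/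

import Mathlib

namespace PlaneCode

open scoped Classical in
/-- The incidence matrix of points `P` and lines `L`, with entries in the field with two elements.
Rows are indexed by lines, columns by points; the `(l, p)` entry is `1` exactly when `p` lies
on `l`. -/
noncomputable def incidenceMatrix (P L : Type*) [Membership P L] : Matrix L P (ZMod 2) :=
  Matrix.of fun l p => if p ∈ l then 1 else 0

/-- The binary code generated by an incidence structure: the subspace spanned over the field
with two elements by the rows of its incidence matrix. -/
noncomputable def code (P L : Type*) [Membership P L] : Submodule (ZMod 2) (P → ZMod 2) :=
  Submodule.span (ZMod 2) (Set.range (incidenceMatrix P L).row)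

end PlaneCode

/-! On the code the sum of the coordinates over a line equals the sum over all points, so the
support `S` of a word of weight 15 meets every line in an odd number of points. Through a point off
`S` there are 11 lines sharing 15 points of `S`, an excess of only four over one point each. Hence
lines meet `S` in 1, 3 or 5 points, and second moments show that exactly six lines are heavy (five
points), two through each point of `S`. So `S` consists of the 15 intersections of six lines,
labelled by the duads of a six-element set. The lines with three points are labelled by the 15
synthemes, and the points off `S` where two of these meet by the 60 pairs of disjoint synthemes; the
union of such a pair is a hexagon.

Any other line is simple: it has one point of `S`, labelled by a duad `d`. It meets each syntheme
line not containing `d` off `S`, in a point where the excess forces exactly one further syntheme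
line. Its hexagons are therefore an exact cover of the synthemes free of `d`, which leaves a finite
list of candidates (`mask_mem_lines`). Moreover the simple lines at `d` partition the hexagons free
of `d`, and simple lines at different duads share at most one hexagon. These facts make up `System`
(`Labelling.system_simpleMasks`).

A computation shows that they are contradictory. Relabelling the six lines acts on everything
(`OddSet.stableClass`), so excluding one candidate excludes its orbit. Nine candidates at the duad
{0, 1} are excluded in turn: given the candidate, no mutually compatible exact covers exist at the
four duads {0, 1}, {2, 3}, {4, 5}, {2, 4}, where candidates from earlier orbits are dropped. The
search is justified by `cover_sound`, `search_sound` and `searchFrom_sound`. The nine orbits contain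
every candidate through the hexagons 25 and 31; yet the line joining these two points exists and is
simple (`not_oddSet`).

Sets are coded as binary numbers and programs written with recursors and basic `Nat` operations, so
that the kernel can evaluate them. -/

noncomputable section
-- Tables for the symmetric group on six letters, and the search program
namespace PlaneCode

/-- The fifteen synthemes (fixed-point-free involutions of `{0, …, 5}`), as lists of values. -/
def synthemes : List (List Nat) :=
  [[1, 0, 3, 2, 5, 4], [1, 0, 4, 5, 2, 3], [1, 0, 5, 4, 3, 2], [2, 3, 0, 1, 5, 4], [2, 4, 0, 5,
   1, 3], [2, 5, 0, 4, 3, 1], [3, 2, 1, 0, 5, 4], [3, 4, 5, 0, 1, 2], [3, 5, 4, 0, 2, 1], [4, 2,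
   1, 5, 0, 3], [4, 3, 5, 1, 0, 2], [4, 5, 3, 2, 0, 1], [5, 2, 1, 4, 3, 0], [5, 3, 4, 1, 2, 0],
   [5, 4, 3, 2, 1, 0]]

/-- The sixty pairs of disjoint synthemes, as pairs of positions in `synthemes`. -/
def hexagons : List (Nat × Nat) :=
  [(2, 11), (11, 12), (4, 10), (11, 13), (6, 13), (2, 4), (4, 11), (2, 3), (10, 14), (1, 14),
   (1, 6), (8, 12), (0, 9), (0, 4), (7, 13), (1, 12), (5, 13), (9, 14), (0, 8), (2, 9), (0, 13),
   (5, 6), (6, 10), (3, 12), (8, 9), (1, 3), (0, 10), (5, 9), (10, 12), (3, 7), (8, 10), (2, 6),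
   (0, 12), (3, 8), (7, 12), (1, 10), (9, 13), (0, 7), (3, 9), (6, 14), (5, 7), (3, 11), (4, 6),
   (1, 5), (1, 11), (4, 13), (5, 10), (2, 8), (3, 14), (0, 5), (4, 8), (1, 7), (5, 14), (6, 11),
   (2, 13), (7, 11), (8, 14), (4, 12), (7, 9), (2, 14)]

/-- The fifteen duads (two-element subsets of `{0, …, 5}`). -/
def duads : List (Nat × Nat) :=
  [(0, 1), (0, 2), (0, 3), (0, 4), (0, 5), (1, 2), (1, 3), (1, 4), (1, 5), (2, 3), (2, 4), (2,
   5), (3, 4), (3, 5), (4, 5)]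

/-- The action of the adjacent transpositions on positions in `duads`. -/
def duadSwap : List (List Nat) :=
  [[0, 5, 6, 7, 8, 1, 2, 3, 4, 9, 10, 11, 12, 13, 14], [1, 0, 2, 3, 4, 5, 9, 10, 11, 6, 7, 8,
   12, 13, 14], [0, 2, 1, 3, 4, 6, 5, 7, 8, 9, 12, 13, 10, 11, 14], [0, 1, 3, 2, 4, 5, 7, 6, 8,
   10, 9, 11, 12, 14, 13], [0, 1, 2, 4, 3, 5, 6, 8, 7, 9, 11, 10, 13, 12, 14]]

/-- The action of the adjacent transpositions on positions in `synthemes`. -/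
def synthemeSwap : List (List Nat) :=
  [[0, 1, 2, 6, 9, 12, 3, 10, 13, 4, 7, 14, 5, 8, 11], [3, 4, 5, 0, 1, 2, 6, 8, 7, 9, 11, 10,
   12, 14, 13], [0, 2, 1, 6, 7, 8, 3, 4, 5, 10, 9, 11, 13, 12, 14], [1, 0, 2, 4, 3, 5, 9, 10,
   11, 6, 7, 8, 12, 14, 13], [0, 2, 1, 3, 5, 4, 6, 8, 7, 12, 13, 14, 9, 10, 11]]

/-- The action of the adjacent transpositions on positions in `hexagons`. -/
def hexSwap : List (List Nat) :=
  [[59, 52, 58, 56, 33, 19, 17, 31, 55, 44, 25, 16, 13, 12, 30, 43, 11, 6, 20, 5, 18, 23, 29,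
   21, 45, 10, 37, 57, 40, 22, 14, 7, 49, 4, 46, 51, 50, 26, 42, 41, 28, 39, 38, 15, 9, 24, 34,
   54, 53, 32, 36, 35, 1, 48, 47, 8, 3, 27, 2, 0], [46, 28, 44, 8, 39, 43, 35, 49, 3, 45, 42,
   34, 38, 25, 56, 57, 59, 36, 29, 27, 48, 31, 53, 32, 58, 13, 41, 19, 1, 18, 55, 21, 23, 37,
   11, 6, 17, 33, 12, 4, 47, 26, 10, 5, 2, 9, 0, 40, 20, 7, 51, 50, 54, 22, 52, 30, 14, 15, 24,
   16], [44, 3, 58, 1, 23, 51, 55, 10, 17, 59, 7, 16, 26, 37, 57, 54, 11, 8, 49, 35, 32, 33, 38,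
   4, 46, 31, 12, 30, 36, 42, 27, 25, 20, 21, 45, 19, 28, 13, 22, 48, 50, 53, 29, 47, 0, 34, 24,
   43, 39, 18, 40, 5, 56, 41, 15, 6, 52, 14, 2, 9], [47, 11, 29, 56, 17, 7, 33, 5, 14, 20, 12,
   1, 10, 25, 8, 32, 52, 4, 44, 31, 9, 27, 58, 57, 53, 13, 51, 21, 34, 2, 55, 19, 15, 6, 28, 37,
   39, 35, 42, 36, 46, 50, 38, 49, 18, 48, 40, 0, 45, 43, 41, 26, 16, 24, 59, 30, 3, 23, 22,
   54], [9, 17, 16, 8, 22, 43, 52, 25, 3, 0, 31, 58, 32, 49, 30, 19, 2, 1, 37, 15, 26, 42, 4,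
   38, 34, 7, 20, 57, 36, 33, 14, 10, 12, 29, 24, 54, 28, 18, 23, 53, 50, 48, 21, 5, 59, 46, 45,
   51, 41, 13, 40, 47, 6, 39, 35, 56, 55, 27, 11, 44]]

/-- Lines through the first duad, one from each of the orbits that have to be excluded. -/
def reps : List Nat :=
  [72059878962626564, 36310340717250564, 157626262909632512, 14636768313737216,
   9289842462558212, 153403863515283456, 10485028781817856, 74792560623624, 9324958400380928]

/-! ### Masks of synthemes and hexagons -/

def nth (l : List Nat) (i : Nat) : Nat := l.getD i 0

/-- The duad at position `d`. -/
def duad (d : Nat) : Nat × Nat := duads.getD d (0, 0)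

/-- The syntheme `s` contains the duad at position `d`. -/
def contains (d : Nat) (s : List Nat) : Bool := Nat.beq (nth s (duad d).1) (duad d).2

def freeAux (d : Nat) (l : List (List Nat)) : Nat :=
  List.rec 0 (fun s _ ih => Nat.add (Nat.mul 2 ih) (cond (contains d s) 0 1)) l

/-- The mask of the synthemes not containing the duad at position `d`. -/
def free (d : Nat) : Nat := freeAux d synthemes

/-- The mask of the two synthemes of a hexagon. -/
def span (h : Nat × Nat) : Nat := Nat.add (Nat.pow 2 h.1) (Nat.pow 2 h.2)

def maskOf (f : Nat × Nat → Bool) (l : List (Nat × Nat)) : Nat :=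
  List.rec 0 (fun h _ ih => Nat.add (Nat.mul 2 ih) (cond (f h) 1 0)) l

/-- The mask of the hexagons whose synthemes do not contain the duad at position `d`. -/
def hexFree (d : Nat) : Nat :=
  maskOf (fun h => Nat.beq (Nat.land (span h) (free d)) (span h)) hexagons

/-- The hexagons in `l` with first syntheme `s`, as pairs of masks of synthemes and hexagons; the
first hexagon of `l` has mask `v`. -/
def options (s : Nat) (l : List (Nat × Nat)) : Nat → List (Nat × Nat) :=
  List.rec (fun _ => [])
    (fun h _ ih v => cond (Nat.beq h.1 s) ((span h, v) :: ih (Nat.mul 2 v)) (ih (Nat.mul 2 v))) l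

/-- A hexagon is entered only under its first, smaller syntheme. This suffices because `covers`
treats the synthemes in increasing order, so the lowest uncovered one is always the first of its
hexagon. -/
def hexTable (n : Nat) : List (Nat × List (Nat × Nat)) :=
  (List.range n).map fun s => (Nat.pow 2 s, options s hexagons 1)

/-- Exact covers of a set of synthemes by hexagons, prepended to a list. -/
def covers (tab : List (Nat × List (Nat × Nat))) : Nat → Nat → List Nat → List Nat :=
  List.rec (fun _ acc rest => acc :: rest)
    (fun e _ ih unc acc rest => Bool.rec
      (List.rec rest
        (fun q _ ih' => Bool.rec ih' (ih (Nat.xor unc q.1) (Nat.add acc q.2) ih')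
          (Nat.beq (Nat.land unc q.1) q.1)) e.2)
      (ih unc acc rest) (Nat.beq (Nat.land unc e.1) 0)) tab

/-- The exact covers by hexagons of the synthemes not containing the duad at position `d`. -/
def lines (d : Nat) : List Nat := covers (hexTable 15) (free d) 0 []

/-! ### Relabelling -/

def packNat (w : Nat) (l : List Nat) : Nat := List.rec 0 (fun a _ ih => Nat.add (Nat.mul w ih) a) l

/-- Removes the lowest binary digit one. -/
def lowErase (x : Nat) : Nat := Nat.land x (Nat.sub x 1)

/-- Keeps the lowest binary digit one. -/
def lowBit (x : Nat) : Nat := Nat.xor x (lowErase x)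

/-- The image of a mask under a map whose values are packed into the digits of `T`. -/
def permute (T : Nat) (n : Nat) : Nat → Nat → Nat :=
  Nat.rec (fun _ acc => acc)
    (fun _ ih x acc => Bool.rec
      (ih (lowErase x)
        (Nat.add acc (Nat.pow 2 (Nat.land (Nat.div T (Nat.pow (lowBit x) 6)) 63))))
      acc (Nat.beq x 0)) n

/-- The action of the `k`-th adjacent transposition on pairs of a duad and a mask of hexagons. -/
def act (k : Nat) (p : Nat × Nat) : Nat × Nat :=
  (nth (duadSwap.getD k []) p.1, permute (packNat 64 (hexSwap.getD k [])) 60 p.2 0)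

/-- With `s j` the transposition of `j` and `j + 1`, this applies 1, `s (k-1)`, `s (k-2) s (k-1)`,
…: coset representatives of the symmetric group on `k` letters in that on `k + 1`. For `k` from 1 to
5 they multiply to all 720 permutations. -/
def orbitStep (k : Nat) : List (Nat × Nat) → List (Nat × Nat) :=
  Nat.rec (fun l => l) (fun j ih l => l ++ ih (l.map (act j))) k

/-- The orbit under the symmetric group, enumerated through coset representatives. -/
def orbit (p : Nat × Nat) : List (Nat × Nat) :=
  orbitStep 5 (orbitStep 4 (orbitStep 3 (orbitStep 2 (orbitStep 1 [p]))))

/-! ### Batches of masks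

Several masks are packed into one number with digits to base `2 ^ 64`, so that a few operations on
large numbers act on all of them. -/

structure Batch where
  ones : Nat
  val : Nat

def push (b : Batch) (x : Nat) : Batch :=
  Batch.rec (fun R A =>
    ⟨Nat.add (Nat.mul 18446744073709551616 R) 1, Nat.add (Nat.mul 18446744073709551616 A) x⟩) b

def pack (l : List Nat) : Batch := List.rec ⟨0, 0⟩ (fun a _ ih => push ih a) l

/-- Masks use 60 bits of each digit, so bit 63 is free to absorb the borrow of a subtraction. -/
def flags (R : Nat) : Nat := Nat.mul 9223372036854775808 R

/-- Digits one at the digits of `w` that are zero. -/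
def zeroFields (R w : Nat) : Nat :=
  Nat.div (Nat.land (Nat.sub (flags R) w) (flags R)) 9223372036854775808

/-- The digits of `A` where `f` has digit one. -/
def keep (A f : Nat) : Nat := Nat.land A (Nat.mul f 9223372036854775807)

/-- Digits one at the digits of `A` that are disjoint from `x`. -/
def disjointFields (R A x : Nat) : Nat := zeroFields R (Nat.land A (Nat.mul x R))

/-- Applies `lowErase` to all digits. -/
def sparse (R y : Nat) : Nat := Nat.land y (Nat.sub (Nat.lor y (flags R)) R)

/-- The digits of `A` with at most one element in common with `x`. -/
def meetPart (R x A : Nat) : Nat := keep A (zeroFields R (sparse R (Nat.land A (Nat.mul x R))))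

/-- The digits of `A` different from `x`. -/
def erasePart (R x A : Nat) : Nat := Nat.xor A (keep A (zeroFields R (Nat.xor A (Nat.mul x R))))

def Batch.map (f : Nat → Nat → Nat) (b : Batch) : Batch := Batch.rec (fun R A => ⟨R, f R A⟩) b

/-- The digit of `A` at the place value `b`. -/
def entry (A b : Nat) : Nat := Nat.land (Nat.div A b) 1152921504606846975

def compactLoop (b : Batch) (A fuel : Nat) : Nat → Batch → Batch :=
  Nat.rec (fun _ _ => b)
    (fun _ ih M acc => Bool.rec (ih (lowErase M) (push acc (entry A (lowBit M)))) acc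
      (Nat.beq M 0)) fuel

/-- Drops the digits zero. -/
def compact (b : Batch) : Batch :=
  Batch.rec (fun R A => compactLoop b A 400 (Nat.xor R (zeroFields R A)) ⟨0, 0⟩) b

/-! ### Exhaustive search

The functions `resume`, `next`, `enter`, `branch`, `step` make up the loop of `cover`. Its state
consists of the flags `F` of the masks that are disjoint from those chosen, the mask `rem` of the
hexagons left to be covered, the flags `M` of the options for the lowest of them, and the list `ch`
of the masks chosen. The search returns `true` if all branches are refuted by `k`. -/

/-- Here `Nat.succ n` is a power `2 ^ b`. Dividing by it moves bit `b` of each digit to the place of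
the flag, which selects the masks containing `b`. -/
def resume (A : Nat) (ih : Nat → Nat → Nat → List Nat → Bool) (F rem : Nat) (ch : List Nat)
    (n : Nat) (_ : Bool) : Bool :=
  ih F rem (Nat.land F (Nat.div A (Nat.succ n))) ch

def next (k : List Nat → Bool) (A : Nat) (ih : Nat → Nat → Nat → List Nat → Bool) (F rem : Nat)
    (ch : List Nat) : Bool :=
  Nat.rec (k ch) (resume A ih F rem ch) (lowBit rem)

def enter (k : List Nat → Bool) (R A : Nat) (ih : Nat → Nat → Nat → List Nat → Bool) (F rem : Nat)
    (ch : List Nat) (x : Nat) : Bool :=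
  next k A ih (Nat.land F (disjointFields R A x)) (Nat.xor rem (Nat.land rem x)) (x :: ch)

def branch (k : List Nat → Bool) (R A : Nat) (ih : Nat → Nat → Nat → List Nat → Bool)
    (F rem M : Nat) (ch : List Nat) (n : Nat) (_ : Bool) : Bool :=
  Bool.rec false (ih F rem (lowErase M) ch) (enter k R A ih F rem ch (Nat.succ n))

/-- When `M` is zero, `lowBit M` and then the entry are zero, which is read as exhaustion of the
options. Genuine options contain a hexagon, so their entries are not zero. -/
def step (k : List Nat → Bool) (R A : Nat) (ih : Nat → Nat → Nat → List Nat → Bool)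
    (F rem M : Nat) (ch : List Nat) : Bool :=
  Nat.rec true (branch k R A ih F rem M ch) (entry A (lowBit M))

def cover (k : List Nat → Bool) (R A fuel : Nat) : Nat → Nat → Nat → List Nat → Bool :=
  Nat.rec (fun _ _ _ _ => false) (fun _ ih => step k R A ih) fuel

/-- Restricts batches to the masks that meet all chosen ones in at most one element. -/
def meet (ch : List Nat) (bs : List Batch) : List Batch :=
  bs.map fun b => compact (List.rec b (fun x _ ih => ih.map (meetPart · x ·)) ch)

/-- Searches for exact covers of the given sets from the given batches. -/
def search (rems : List Nat) : List Batch → Bool :=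
  List.rec (fun _ => false)
    (fun rem _ ih bs => List.rec false (fun b bs _ =>
       Batch.rec (fun R A => cover (fun ch => ih (meet ch bs)) R A 1000 R rem
         (Nat.land R (Nat.div A (lowBit rem))) []) b) bs) rems

/-- The same search with one mask given, and the options for the second restricted to `sel`. -/
def searchFrom (rem : Nat) (rems : List Nat) (x sel : Nat) (b : Batch) (bs : List Batch) : Bool :=
  Batch.rec (fun R A =>
    (fun rem' F' => cover (fun ch => search rems (meet ch bs)) R A 1000 F' rem'
      (Nat.land sel (Nat.land F' (Nat.div A (lowBit rem')))) [x])
    (Nat.xor rem x) (disjointFields R A x)) b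

/-- The batch of all lines of a duad that are not excluded. -/
def candidates (ex : List (Nat × Nat)) (d : Nat) : Batch :=
  List.rec (pack (lines d))
    (fun e _ ih => Bool.rec ih (ih.map (erasePart · e.2 ·)) (Nat.beq e.1 d)) ex

/-- Refutes the mask `x` at the first duad by a search at four duads. -/
def refute (ex : List (Nat × Nat)) (x sel : Nat) : Bool :=
  searchFrom (hexFree 0) [hexFree 9, hexFree 14, hexFree 10] x sel (candidates ex 0)
    [candidates ex 9, candidates ex 14, candidates ex 10]

end PlaneCode
end

/-! ### Digitwise arithmetic to base `2 ^ 64` -/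

namespace PlaneCode

/-- The number with the digits `f 0, …, f (n - 1)` to base `2 ^ 64`. -/
def word (n : ℕ) (f : ℕ → ℕ) : ℕ := ∑ i ∈ Finset.range n, 2 ^ (64 * i) * f i

theorem word_succ (n : ℕ) (f : ℕ → ℕ) :
    word (n + 1) f = 2 ^ 64 * word n (fun i => f (i + 1)) + f 0 := by
  unfold word
  rw [Finset.sum_range_succ', Finset.mul_sum, mul_zero, pow_zero, one_mul]
  refine congrArg (· + f 0) (Finset.sum_congr rfl fun i _ => ?_)
  rw [← mul_assoc, ← pow_add, mul_add_one, add_comm]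

theorem testBit_word (n : ℕ) (f : ℕ → ℕ) (hf : ∀ i < n, f i < 2 ^ 64) (j : ℕ) :
    (word n f).testBit j = (decide (j / 64 < n) && (f (j / 64)).testBit (j % 64)) := by
  induction n generalizing f j with
  | zero => simp [word]
  | succ n ih =>
    rw [word_succ, Nat.testBit_two_pow_mul_add _ (hf 0 (by omega)),
      ih (fun i => f (i + 1)) (fun i hi => hf (i + 1) (by omega))]
    split_ifs with h
    · rw [Nat.div_eq_of_lt h, Nat.mod_eq_of_lt h]; simp
    · obtain ⟨k, rfl⟩ : ∃ k, j = k + 64 := ⟨j - 64, by omega⟩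
      simp

theorem word_congr {n : ℕ} {f g : ℕ → ℕ} (h : ∀ i < n, f i = g i) : word n f = word n g :=
  Finset.sum_congr rfl fun i hi => by rw [h i (Finset.mem_range.1 hi)]

theorem word_mul (n : ℕ) (f : ℕ → ℕ) (c : ℕ) : c * word n f = word n fun i => c * f i := by
  unfold word
  rw [Finset.mul_sum]
  exact Finset.sum_congr rfl fun i _ => by ring

theorem word_sub {n : ℕ} {f g : ℕ → ℕ} (h : ∀ i < n, g i ≤ f i) :
    word n f - word n g = word n fun i => f i - g i := by
  rw [Nat.sub_eq_iff_eq_add]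
  · unfold word
    rw [← Finset.sum_add_distrib]
    refine Finset.sum_congr rfl fun i hi => ?_
    rw [← mul_add, Nat.sub_add_cancel (h i (Finset.mem_range.1 hi))]
  · exact Finset.sum_le_sum fun i hi => Nat.mul_le_mul_left _ (h i (Finset.mem_range.1 hi))

theorem word_land {n : ℕ} {f g : ℕ → ℕ} (hf : ∀ i < n, f i < 2 ^ 64) (hg : ∀ i < n, g i < 2 ^ 64) :
    word n f &&& word n g = word n fun i => f i &&& g i := by
  refine Nat.eq_of_testBit_eq fun j => ?_
  rw [Nat.testBit_and, testBit_word n f hf, testBit_word n g hg,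
    testBit_word n _ (fun i hi => Nat.and_lt_two_pow _ (hg i hi)), Nat.testBit_and]
  cases decide (j / 64 < n) <;> simp

theorem word_lor {n : ℕ} {f g : ℕ → ℕ} (hf : ∀ i < n, f i < 2 ^ 64) (hg : ∀ i < n, g i < 2 ^ 64) :
    word n f ||| word n g = word n fun i => f i ||| g i := by
  refine Nat.eq_of_testBit_eq fun j => ?_
  rw [Nat.testBit_or, testBit_word n f hf, testBit_word n g hg,
    testBit_word n _ (fun i hi => Nat.or_lt_two_pow (hf i hi) (hg i hi)), Nat.testBit_or]
  cases decide (j / 64 < n) <;> simp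

theorem word_xor {n : ℕ} {f g : ℕ → ℕ} (hf : ∀ i < n, f i < 2 ^ 64) (hg : ∀ i < n, g i < 2 ^ 64) :
    word n f ^^^ word n g = word n fun i => f i ^^^ g i := by
  refine Nat.eq_of_testBit_eq fun j => ?_
  rw [Nat.testBit_xor, testBit_word n f hf, testBit_word n g hg,
    testBit_word n _ (fun i hi => Nat.xor_lt_two_pow (hf i hi) (hg i hi)), Nat.testBit_xor]
  cases decide (j / 64 < n) <;> simp

/-- The word all of whose digits are one. -/
abbrev onesWord (n : ℕ) : ℕ := word n fun _ => 1

theorem flags_onesWord (n : ℕ) : flags (onesWord n) = word n fun _ => 2 ^ 63 := by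
  have h := word_mul n (fun _ => 1) (2 ^ 63)
  simpa [flags] using h

/-- For `f i < 2 ^ 63` the difference `2 ^ 63 - f i` has bit 63 exactly when `f i = 0`, and no
borrow passes between digits. -/
theorem zeroFields_word {n : ℕ} {f : ℕ → ℕ} (hf : ∀ i < n, f i < 2 ^ 63) :
    zeroFields (onesWord n) (word n f) = word n fun i => if f i = 0 then 1 else 0 := by
  have h : (flags (onesWord n) - word n f) &&& flags (onesWord n) =
      2 ^ 63 * word n fun i => if f i = 0 then 1 else 0 := by
    rw [flags_onesWord, word_sub (fun i hi => (hf i hi).le),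
      word_land (fun i _ => (Nat.sub_le _ _).trans_lt (by norm_num)) (fun i _ => by norm_num),
      word_mul]
    refine word_congr fun i hi => ?_
    rw [Nat.and_two_pow]
    split_ifs with h0
    · rw [h0]; rfl
    · rw [Nat.testBit_lt_two_pow (by omega)]; simp
  change ((flags (onesWord n) - word n f) &&& flags (onesWord n)) / 9223372036854775808 = _
  rw [h]
  exact Nat.mul_div_cancel_left _ (by norm_num)

theorem keep_word {n : ℕ} {f : ℕ → ℕ} (hf : ∀ i < n, f i < 2 ^ 63) (p : ℕ → Prop)
    [DecidablePred p] :
    keep (word n f) (word n fun i => if p i then 1 else 0) =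
      word n fun i => if p i then f i else 0 := by
  change word n f &&& (word n _ * 9223372036854775807) = _
  rw [mul_comm, word_mul, word_land (fun i hi => (hf i hi).trans (by norm_num))
    (fun i _ => by split_ifs <;> norm_num)]
  refine word_congr fun i hi => ?_
  split_ifs
  · have h := Nat.and_two_pow_sub_one_eq_mod (f i) 63
    rw [Nat.mod_eq_of_lt (hf i hi)] at h
    simpa using h
  · simp

theorem land_mul_onesWord {n : ℕ} {a : ℕ → ℕ} {x : ℕ} (ha : ∀ i < n, a i < 2 ^ 63)
    (hx : x < 2 ^ 63) :
    word n a &&& (x * onesWord n) = word n fun i => a i &&& x := by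
  rw [word_mul, word_land (fun i hi => (ha i hi).trans (by norm_num))
    (fun i _ => by rw [mul_one]; exact hx.trans (by norm_num))]
  simp

theorem disjointFields_word {n : ℕ} {a : ℕ → ℕ} {x : ℕ} (ha : ∀ i < n, a i < 2 ^ 63)
    (hx : x < 2 ^ 63) :
    disjointFields (onesWord n) (word n a) x = word n fun i => if a i &&& x = 0 then 1 else 0 := by
  change zeroFields _ (word n a &&& (x * onesWord n)) = _
  rw [land_mul_onesWord ha hx]
  exact zeroFields_word fun i _ => Nat.and_lt_two_pow _ hx

/-- Setting bit 63 first keeps the subtraction of one inside each digit, even a zero digit; the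
final conjunction with `f i` removes that bit again. -/
theorem sparse_word {n : ℕ} {f : ℕ → ℕ} (hf : ∀ i < n, f i < 2 ^ 63) :
    sparse (onesWord n) (word n f) = word n fun i => lowErase (f i) := by
  have hor (i) (hi : i < n) : f i ||| 2 ^ 63 = 2 ^ 63 + f i := by
    have := Nat.two_pow_add_eq_or_of_lt (hf i hi) 1
    rw [Nat.lor_comm]; simpa using this.symm
  change word n f &&& ((word n f ||| flags (onesWord n)) - onesWord n) = _
  have h64 : ∀ i < n, f i < 2 ^ 64 := fun i hi => (hf i hi).trans (by norm_num)
  rw [flags_onesWord, word_lor h64 (fun i _ => by norm_num),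
    word_sub (fun i hi => by rw [hor i hi]; have := Nat.two_pow_pos 63; omega),
    word_land h64 (fun i hi => by rw [hor i hi]; have := hf i hi; omega)]
  refine word_congr fun i hi => ?_
  rw [hor i hi]
  change _ = f i &&& (f i - 1)
  rcases Nat.eq_zero_or_pos (f i) with h | h
  · simp [h]
  · rw [Nat.add_sub_assoc h]
    have := Nat.two_pow_add_eq_or_of_lt (show f i - 1 < 2 ^ 63 by have := hf i hi; omega) 1
    rw [mul_one] at this
    rw [this, Nat.and_or_distrib_left, Nat.and_two_pow, Nat.testBit_lt_two_pow (hf i hi)]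
    simp

theorem meetPart_word {n : ℕ} {a : ℕ → ℕ} {x : ℕ} (ha : ∀ i < n, a i < 2 ^ 63) (hx : x < 2 ^ 63) :
    meetPart (onesWord n) x (word n a) =
      word n fun i => if lowErase (a i &&& x) = 0 then a i else 0 := by
  change keep _ (zeroFields _ (sparse _ (word n a &&& (x * onesWord n)))) = _
  rw [land_mul_onesWord ha hx, sparse_word (fun i _ => Nat.and_lt_two_pow _ hx),
    zeroFields_word fun i _ => ?_, keep_word ha]
  exact Nat.lt_of_le_of_lt (Nat.and_le_left) (Nat.and_lt_two_pow _ hx)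

/-- Erased masks become zero and keep their place. A zero digit contains no hexagon, so it is never
an option. -/
theorem erasePart_word {n : ℕ} {a : ℕ → ℕ} {x : ℕ} (ha : ∀ i < n, a i < 2 ^ 63) (hx : x < 2 ^ 63) :
    erasePart (onesWord n) x (word n a) = word n fun i => if a i = x then 0 else a i := by
  change word n a ^^^ (keep _ (zeroFields _ (word n a ^^^ (x * onesWord n)))) = _
  have h64 : ∀ i < n, a i < 2 ^ 64 := fun i hi => (ha i hi).trans (by norm_num)
  rw [word_mul, word_xor h64 (fun i _ => by rw [mul_one]; exact hx.trans (by norm_num)),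
    zeroFields_word (fun i hi => by rw [mul_one]; exact Nat.xor_lt_two_pow (ha i hi) hx),
    keep_word ha, word_xor h64 (fun i hi => by
      split_ifs
      exacts [h64 i hi, by norm_num])]
  refine word_congr fun i hi => ?_
  simp only [mul_one, Nat.xor_eq_zero_iff]
  split_ifs with h <;> simp

end PlaneCode

/-! ### Lowest bits, and soundness of the exact cover search -/

namespace PlaneCode

theorem lowErase_eq (j q : ℕ) : lowErase (2 ^ (j + 1) * q + 2 ^ j) = 2 ^ (j + 1) * q := by
  have hpos : 0 < 2 ^ j := Nat.two_pow_pos j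
  have hlt : 2 ^ j < 2 ^ (j + 1) := Nat.pow_lt_pow_right (by norm_num) (by omega)
  change (2 ^ (j + 1) * q + 2 ^ j) &&& (2 ^ (j + 1) * q + 2 ^ j - 1) = _
  rw [Nat.add_sub_assoc hpos]
  refine Nat.eq_of_testBit_eq fun i => ?_
  have h0 := Nat.testBit_two_pow_mul_add q (Nat.two_pow_pos (j + 1)) i
  rw [Nat.testBit_and, Nat.testBit_two_pow_mul_add q hlt,
    Nat.testBit_two_pow_mul_add q (show 2 ^ j - 1 < 2 ^ (j + 1) by omega)]
  rw [add_zero] at h0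
  rw [h0]
  split_ifs with h
  · rw [Nat.testBit_two_pow, Nat.testBit_two_pow_sub_one, Nat.zero_testBit]
    by_cases hij : j = i <;> simp [hij]
  · simp

theorem exists_eq_lowBit {M : ℕ} (hM : M ≠ 0) :
    ∃ j q, M = 2 ^ (j + 1) * q + 2 ^ j := by
  obtain ⟨j, m, ⟨q, rfl⟩, rfl⟩ := Nat.exists_eq_two_pow_mul_odd hM
  exact ⟨j, q, by ring⟩

theorem lowBit_spec {M : ℕ} (hM : M ≠ 0) :
    ∃ j, M.testBit j = true ∧ lowBit M = 2 ^ j ∧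
      ∀ i, (lowErase M).testBit i = (M.testBit i && decide (i ≠ j)) := by
  obtain ⟨j, q, rfl⟩ := exists_eq_lowBit hM
  have hlt : 2 ^ j < 2 ^ (j + 1) := Nat.pow_lt_pow_right (by norm_num) (by omega)
  have h1 (i) := Nat.testBit_two_pow_mul_add q hlt i
  have h0 (i) := Nat.testBit_two_pow_mul_add q (Nat.two_pow_pos (j + 1)) i
  simp only [add_zero] at h0
  refine ⟨j, by rw [h1]; simp, ?_, fun i => ?_⟩
  · change _ ^^^ lowErase _ = _
    rw [lowErase_eq]
    refine Nat.eq_of_testBit_eq fun i => ?_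
    rw [Nat.testBit_xor, h0, h1]
    split_ifs with h
    · simp
    · rw [Nat.testBit_two_pow_of_ne (by omega)]; simp
  · rw [lowErase_eq, h0, h1]
    split_ifs with h
    · rw [Nat.testBit_two_pow, Nat.zero_testBit]
      by_cases hij : j = i <;> simp [hij]
    · have : i ≠ j := by omega
      simp [this]

theorem testBit_flagWord (n : ℕ) (p : ℕ → Bool) (j : ℕ) :
    (word n fun i => if p i then 1 else 0).testBit j = true ↔ ∃ i < n, j = 64 * i ∧ p i = true := by
  rw [testBit_word n _ (fun i _ => by split_ifs <;> norm_num)]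
  simp only [Bool.and_eq_true, decide_eq_true_eq]
  constructor
  · rintro ⟨h, hb⟩
    split_ifs at hb with hp
    · rw [Nat.testBit_one_eq_true_iff_self_eq_zero] at hb
      exact ⟨_, h, by omega, hp⟩
    · simp at hb
  · rintro ⟨i, hi, rfl, hp⟩
    simp [hi, hp]

theorem testBit_word_add {n : ℕ} {a : ℕ → ℕ} (ha : ∀ i < n, a i < 2 ^ 60) {i b : ℕ} (hi : i < n)
    (hb : b < 64) : (word n a).testBit (64 * i + b) = (a i).testBit b := by
  rw [testBit_word n a (fun i hi => (ha i hi).trans (by norm_num))]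
  have h1 : (64 * i + b) / 64 = i := by omega
  have h2 : (64 * i + b) % 64 = b := by omega
  simp [h1, h2, hi]

theorem entry_word {n : ℕ} {a : ℕ → ℕ} (ha : ∀ i < n, a i < 2 ^ 60) {i : ℕ} (hi : i < n) :
    entry (word n a) (2 ^ (64 * i)) = a i := by
  change (word n a / 2 ^ (64 * i)) &&& (2 ^ 60 - 1) = _
  refine Nat.eq_of_testBit_eq fun j => ?_
  rw [Nat.testBit_and, Nat.testBit_div_two_pow, Nat.testBit_two_pow_sub_one]
  by_cases hj : j < 60
  · rw [add_comm j, testBit_word_add ha hi (by omega)]; simp [hj]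
  · rw [Nat.testBit_lt_two_pow ((ha i hi).trans_le (Nat.pow_le_pow_right (by norm_num)
      (not_lt.1 hj)))]
    simp [hj]

/-- Fields containing a given point, among the flagged ones. -/
theorem testBit_options {n : ℕ} {a : ℕ → ℕ} (ha : ∀ i < n, a i < 2 ^ 60) (p : ℕ → Bool) {b : ℕ}
    (hb : b < 60) (j : ℕ) :
    ((word n fun i => if p i then 1 else 0) &&& (word n a / 2 ^ b)).testBit j = true ↔
      ∃ i < n, j = 64 * i ∧ p i = true ∧ (a i).testBit b = true := by
  rw [Nat.testBit_and, Bool.and_eq_true, testBit_flagWord, Nat.testBit_div_two_pow]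
  constructor
  · rintro ⟨⟨i, hi, rfl, hp⟩, h⟩
    rw [testBit_word_add ha hi (by omega)] at h
    exact ⟨i, hi, rfl, hp, h⟩
  · rintro ⟨i, hi, rfl, hp, h⟩
    exact ⟨⟨i, hi, rfl, hp⟩, by rwa [testBit_word_add ha hi (by omega)]⟩

theorem next_zero (k : List ℕ → Bool) (A : ℕ) (ih : ℕ → ℕ → ℕ → List ℕ → Bool) (F : ℕ)
    (ch : List ℕ) : next k A ih F 0 ch = k ch := rfl

theorem next_of_lowBit (k : List ℕ → Bool) (A : ℕ) (ih : ℕ → ℕ → ℕ → List ℕ → Bool) (F : ℕ)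
    {rem b : ℕ} (h : lowBit rem = 2 ^ b) (ch : List ℕ) :
    next k A ih F rem ch = ih F rem (F &&& (A / 2 ^ b)) ch := by
  obtain ⟨m, hm⟩ : ∃ m, 2 ^ b = m + 1 := ⟨2 ^ b - 1, by have := Nat.two_pow_pos b; omega⟩
  unfold next
  rw [h, hm]
  rfl

theorem step_succ (k : List ℕ → Bool) (R A : ℕ) (ih : ℕ → ℕ → ℕ → List ℕ → Bool)
    (F rem M : ℕ) (ch : List ℕ) (h : entry A (lowBit M) ≠ 0)
    (hs : step k R A ih F rem M ch = true) :
    enter k R A ih F rem ch (entry A (lowBit M)) = true ∧ ih F rem (lowErase M) ch = true := by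
  unfold step at hs
  obtain ⟨m, hm⟩ := Nat.exists_eq_succ_of_ne_zero h
  rw [hm] at hs ⊢
  change Bool.rec false (ih F rem (lowErase M) ch) (enter k R A ih F rem ch (Nat.succ m)) = true
    at hs
  cases he : enter k R A ih F rem ch (Nat.succ m) <;> rw [he] at hs
  · cases hs
  · exact ⟨rfl, hs⟩

/-- The exhaustive search for an exact cover of `U` by members of `X` reaches every such cover. -/
theorem cover_sound {X : Set ℕ} {U n : ℕ} {a : ℕ → ℕ} (ha : ∀ i < n, a i < 2 ^ 60)
    (hX : ∀ x ∈ X, ∀ y ∈ X, x ≠ y → x &&& y = 0) (hlt : U < 2 ^ 60)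
    (hU : ∀ b, U.testBit b = true → ∃ x ∈ X, x.testBit b = true)
    {k : List ℕ → Bool} (hk : ∀ ch, (∀ y ∈ ch, y ∈ X) → k ch = true → False) (fuel : ℕ)
    {F rem M b : ℕ} {ch : List ℕ} (p : ℕ → Bool)
    (hF : F = word n fun i => if p i then 1 else 0)
    (hrem : ∀ c, rem.testBit c = true → U.testBit c = true) (hb : rem.testBit b = true)
    (hp : ∀ x ∈ X, x &&& rem ≠ 0 → ∃ i < n, a i = x ∧ p i = true)
    (hch : ∀ y ∈ ch, y ∈ X)
    (hM : ∀ j, M.testBit j = true → ∃ i < n, j = 64 * i ∧ a i ≠ 0)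
    (hMX : ∀ x ∈ X, x.testBit b = true → ∃ i < n, a i = x ∧ M.testBit (64 * i) = true)
    (h : cover k (onesWord n) (word n a) fuel F rem M ch = true) : False := by
  induction fuel generalizing F rem M b ch p with
  -- Without fuel the search returns `false`, so the amount of fuel needs no justification.
  | zero => cases h
  | succ fuel ih =>
    change step k (onesWord n) (word n a) (cover k (onesWord n) (word n a) fuel) F rem M ch = true
      at h
    -- The member of `X` through `b` is still flagged in `M`, so the options cannot be exhausted.
    obtain ⟨x, hxX, hxb⟩ := hU b (hrem b hb)
    obtain ⟨i, hi, hix, hiM⟩ := hMX x hxX hxb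
    have hM0 : M ≠ 0 := by rintro rfl; simp at hiM
    obtain ⟨j, hj, hlow, herase⟩ := lowBit_spec hM0
    obtain ⟨m, hm, rfl, ham⟩ := hM j hj
    have hentry : entry (word n a) (lowBit M) = a m := by rw [hlow, entry_word ha hm]
    obtain ⟨h1, h2⟩ := step_succ _ _ _ _ _ _ _ _ (by rwa [hentry]) h
    rw [hentry] at h1
    -- If the current option belongs to `X`, the search is followed into its branch; otherwise it is
    -- followed to the remaining options, among which the member through `b` survives.
    by_cases hmX : a m ∈ X
    · have hsub : ∀ c, (rem ^^^ (rem &&& a m)).testBit c = (rem.testBit c && !(a m).testBit c) := by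
        intro c
        rw [Nat.testBit_xor, Nat.testBit_and]
        cases rem.testBit c <;> simp
      -- A member that still meets the remainder differs from `a m`, hence is disjoint from it and
      -- keeps its flag.
      have hp' : ∀ x ∈ X, x &&& (rem ^^^ (rem &&& a m)) ≠ 0 →
          ∃ i < n, a i = x ∧ (p i && decide (a i &&& a m = 0)) = true := by
        intro x hx hne
        obtain ⟨c, hc⟩ := Nat.exists_testBit_of_ne_zero hne
        rw [Nat.testBit_and, hsub] at hc
        simp only [Bool.and_eq_true, Bool.not_eq_true'] at hc
        obtain ⟨i, hi, rfl, hpi⟩ := hp x hx (by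
          intro h0
          have : (x &&& rem).testBit c = true := by rw [Nat.testBit_and, hc.1, hc.2.1]; rfl
          rw [h0] at this; simp at this)
        refine ⟨i, hi, rfl, ?_⟩
        have hne : a i ≠ a m := by
          intro h0; rw [h0] at hc; rw [hc.2.2] at hc; simp at hc
        simp [hpi, hX _ hx _ hmX hne]
      have hF' : F &&& disjointFields (onesWord n) (word n a) (a m) =
          word n fun i => if (p i && decide (a i &&& a m = 0)) then 1 else 0 := by
        rw [hF, disjointFields_word (fun i hi => (ha i hi).trans (by norm_num))
          ((ha m hm).trans (by norm_num)), word_land (fun i _ => by split_ifs <;> norm_num)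
          (fun i _ => by split_ifs <;> norm_num)]
        refine word_congr fun i _ => ?_
        by_cases h1 : p i = true <;> by_cases h2 : a i &&& a m = 0 <;> simp [h1, h2]
      have hch' : ∀ y ∈ a m :: ch, y ∈ X := by
        intro y hy
        rcases List.mem_cons.1 hy with rfl | hy
        · exact hmX
        · exact hch y hy
      change next k (word n a) (cover k (onesWord n) (word n a) fuel)
        (F &&& disjointFields (onesWord n) (word n a) (a m)) (rem ^^^ (rem &&& a m)) (a m :: ch)
        = true at h1
      rcases eq_or_ne (rem ^^^ (rem &&& a m)) 0 with h0 | h0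
      · rw [h0, next_zero] at h1
        exact hk _ hch' h1
      · obtain ⟨c, hc, hclow, -⟩ := lowBit_spec h0
        have hcU : U.testBit c = true := by
          rw [hsub] at hc
          exact hrem c (Bool.and_eq_true_iff.1 hc).1
        have hc60 : c < 60 := by
          by_contra hcon
          rw [Nat.testBit_lt_two_pow (hlt.trans_le (Nat.pow_le_pow_right (by norm_num)
            (not_lt.1 hcon)))] at hcU
          cases hcU
        rw [next_of_lowBit _ _ _ _ hclow] at h1
        refine ih (b := c) _ hF' (fun d hd => hrem d ?_) hc hp' hch' ?_ ?_ h1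
        · rw [hsub] at hd
          exact (Bool.and_eq_true_iff.1 hd).1
        · intro j hj
          rw [hF', testBit_options ha _ hc60] at hj
          obtain ⟨i, hi, rfl, -, hbit⟩ := hj
          exact ⟨i, hi, rfl, by intro h0; rw [h0] at hbit; simp at hbit⟩
        · intro x hx hxc
          obtain ⟨i, hi, rfl, hpi⟩ := hp' x hx (by
            intro h0
            have : (x &&& (rem ^^^ (rem &&& a m))).testBit c = true := by
              rw [Nat.testBit_and, hxc, hc]; rfl
            rw [h0] at this; simp at this)
          refine ⟨i, hi, rfl, ?_⟩
          rw [hF', testBit_options ha _ hc60]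
          exact ⟨i, hi, rfl, hpi, hxc⟩
    · refine ih p hF hrem hb hp hch (fun j hj => hM j ?_) (fun x hx hxb => ?_) h2
      · rw [herase] at hj
        exact (Bool.and_eq_true_iff.1 hj).1
      · obtain ⟨i, hi, hix, hiM⟩ := hMX x hx hxb
        refine ⟨i, hi, hix, ?_⟩
        rw [herase, hiM]
        have : i ≠ m := by rintro rfl; exact hmX (hix ▸ hx)
        simp [this]

end PlaneCode

/-! ### Batches of candidates, systems, and the search over several duads -/

namespace PlaneCode

/-- The batch consists of `n` numbers below `2 ^ 60`, among them all members of `X`. -/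
def Batch.Holds (b : Batch) (n : ℕ) (X : Set ℕ) : Prop :=
  ∃ a : ℕ → ℕ, b = ⟨onesWord n, word n a⟩ ∧ (∀ i < n, a i < 2 ^ 60) ∧ ∀ x ∈ X, ∃ i < n, a i = x

theorem push_eq (n : ℕ) (a : ℕ → ℕ) (x : ℕ) :
    push ⟨onesWord n, word n a⟩ x =
      ⟨onesWord (n + 1), word (n + 1) fun i => Nat.casesOn i x a⟩ := by
  have h : onesWord (n + 1) = 2 ^ 64 * onesWord n + 1 := word_succ _ _
  rw [h, word_succ]
  rfl

theorem Batch.Holds.push {b : Batch} {n : ℕ} {X : Set ℕ} (h : b.Holds n X) {x : ℕ}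
    (hx : x < 2 ^ 60) : (push b x).Holds (n + 1) (insert x X) := by
  obtain ⟨a, rfl, ha, hX⟩ := h
  refine ⟨_, push_eq n a x, ?_, ?_⟩
  · rintro (_ | i) hi
    · exact hx
    · exact ha i (by omega)
  · rintro y (rfl | hy)
    · exact ⟨0, by omega, rfl⟩
    · obtain ⟨i, hi, rfl⟩ := hX y hy
      exact ⟨i + 1, by omega, rfl⟩

theorem Batch.Holds.mono {b : Batch} {n : ℕ} {X Y : Set ℕ} (h : b.Holds n X) (hY : Y ⊆ X) :
    b.Holds n Y := by
  obtain ⟨a, hb, ha, hX⟩ := h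
  exact ⟨a, hb, ha, fun x hx => hX x (hY hx)⟩

theorem holds_pack (l : List ℕ) (hl : ∀ x ∈ l, x < 2 ^ 60) :
    (pack l).Holds l.length {x | x ∈ l} := by
  induction l with
  | nil => exact ⟨fun _ => 0, rfl, by simp, by simp⟩
  | cons x l ih =>
    refine ((ih fun y hy => hl y (by simp [hy])).push (hl x (by simp))).mono fun y hy => ?_
    simpa using hy

theorem Batch.Holds.meetPart {b : Batch} {n : ℕ} {X : Set ℕ} (h : b.Holds n X) {y : ℕ}
    (hy : y < 2 ^ 60) (hXy : ∀ x ∈ X, lowErase (x &&& y) = 0) :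
    (b.map (meetPart · y ·)).Holds n X := by
  obtain ⟨a, rfl, ha, hX⟩ := h
  refine ⟨fun i => if lowErase (a i &&& y) = 0 then a i else 0, ?_, fun i hi => ?_, fun x hx => ?_⟩
  · rw [← meetPart_word (fun i hi => (ha i hi).trans (by norm_num)) (hy.trans (by norm_num))]
    rfl
  · dsimp only
    split_ifs
    exacts [ha i hi, by norm_num]
  · obtain ⟨i, hi, rfl⟩ := hX x hx
    exact ⟨i, hi, by simp [hXy _ hx]⟩

theorem Batch.Holds.erasePart {b : Batch} {n : ℕ} {X : Set ℕ} (h : b.Holds n X) {y : ℕ}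
    (hy : y < 2 ^ 60) (hXy : y ∉ X) : (b.map (erasePart · y ·)).Holds n X := by
  obtain ⟨a, rfl, ha, hX⟩ := h
  refine ⟨fun i => if a i = y then 0 else a i, ?_, fun i hi => ?_, fun x hx => ?_⟩
  · rw [← erasePart_word (fun i hi => (ha i hi).trans (by norm_num)) (hy.trans (by norm_num))]
    rfl
  · dsimp only
    split_ifs
    exacts [by norm_num, ha i hi]
  · obtain ⟨i, hi, rfl⟩ := hX x hx
    refine ⟨i, hi, if_neg ?_⟩
    rintro rfl
    exact hXy hx

theorem compactLoop_succ (b : Batch) (A fuel M : ℕ) (acc : Batch) :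
    compactLoop b A (fuel + 1) M acc =
      if M = 0 then acc else
        compactLoop b A fuel (lowErase M) (push acc (entry A (lowBit M))) := by
  rcases M with _ | M
  · rfl
  · rw [if_neg (by omega)]; rfl

/-- When the fuel runs out the original batch is returned, which also holds `X`; so the bound 400
needs no proof. -/
theorem holds_compactLoop {X : Set ℕ} {n : ℕ} {a : ℕ → ℕ} (ha : ∀ i < n, a i < 2 ^ 60)
    {b : Batch} {m : ℕ} (hb : b.Holds m X) (fuel : ℕ) {M : ℕ} {acc : Batch} {m' : ℕ} {Y : Set ℕ}
    (hacc : acc.Holds m' Y) (hM : ∀ j, M.testBit j = true → ∃ i < n, j = 64 * i)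
    (hX : ∀ x ∈ X, x ∈ Y ∨ ∃ i < n, a i = x ∧ M.testBit (64 * i) = true) :
    ∃ m, (compactLoop b (word n a) fuel M acc).Holds m X := by
  induction fuel generalizing M acc m' Y with
  | zero => exact ⟨m, hb⟩
  | succ fuel ih =>
    rw [compactLoop_succ]
    split_ifs with h0
    · refine ⟨m', hacc.mono fun x hx => (hX x hx).resolve_right ?_⟩
      rintro ⟨i, -, -, h⟩
      simp [h0] at h
    · obtain ⟨j, hj, hlow, herase⟩ := lowBit_spec h0
      obtain ⟨i, hi, rfl⟩ := hM j hj
      rw [hlow, entry_word ha hi]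
      refine ih (hacc.push (ha i hi)) (fun j hj => hM j ?_) fun x hx => ?_
      · rw [herase] at hj
        exact (Bool.and_eq_true_iff.1 hj).1
      · rcases hX x hx with h | ⟨i', hi', rfl, h⟩
        · exact Or.inl (Or.inr h)
        · rcases eq_or_ne i' i with rfl | hne
          · exact Or.inl (Or.inl rfl)
          · refine Or.inr ⟨i', hi', rfl, ?_⟩
            rw [herase, h]
            simpa using hne

theorem compact_mk (R A : ℕ) :
    compact ⟨R, A⟩ = compactLoop ⟨R, A⟩ A 400 (R ^^^ zeroFields R A) ⟨0, 0⟩ := rfl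

theorem Batch.Holds.compact {b : Batch} {n : ℕ} {X : Set ℕ} (h : b.Holds n X)
    (hX0 : ∀ x ∈ X, x ≠ 0) : ∃ m, (compact b).Holds m X := by
  have hb := h
  obtain ⟨a, rfl, ha, hX⟩ := h
  have hM : onesWord n ^^^ zeroFields (onesWord n) (word n a) =
      word n fun i => if decide (a i ≠ 0) = true then 1 else 0 := by
    rw [zeroFields_word (fun i hi => (ha i hi).trans (by norm_num)), onesWord,
      word_xor (fun i _ => by norm_num) (fun i _ => by split_ifs <;> norm_num)]
    refine word_congr fun i _ => ?_
    by_cases h : a i = 0 <;> simp [h]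
  rw [compact_mk, hM]
  refine holds_compactLoop (Y := ∅) (m' := 0) ha hb 400 ⟨fun _ => 0, rfl, by simp, by simp⟩
    (fun j hj => ?_) fun x hx => ?_
  · rw [testBit_flagWord] at hj
    obtain ⟨i, hi, rfl, -⟩ := hj
    exact ⟨i, hi, rfl⟩
  · obtain ⟨i, hi, rfl⟩ := hX x hx
    exact Or.inr ⟨i, hi, rfl, (testBit_flagWord _ _ _).2 ⟨i, hi, rfl, by simpa using hX0 _ hx⟩⟩

theorem Batch.Holds.meet {b : Batch} {n : ℕ} {X : Set ℕ} (h : b.Holds n X) (ch : List ℕ)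
    (hch : ∀ y ∈ ch, y < 2 ^ 60) (hX : ∀ y ∈ ch, ∀ x ∈ X, lowErase (x &&& y) = 0)
    (hX0 : ∀ x ∈ X, x ≠ 0) :
    ∃ m, (PlaneCode.compact
      (List.rec b (fun x _ ih => ih.map (PlaneCode.meetPart · x ·)) ch)).Holds m X := by
  refine Batch.Holds.compact (n := n) ?_ hX0
  induction ch with
  | nil => exact h
  | cons y ch ih =>
    exact (ih (fun z hz => hch z (by simp [hz])) fun z hz => hX z (by simp [hz])).meetPart
      (hch y (by simp)) (hX y (by simp))

/-- Families of sets of hexagons (as bit masks), indexed by duads, behaving like the simple lines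
of a configuration. -/
structure System (X : ℕ → Set ℕ) : Prop where
  mem_lines : ∀ d < 15, ∀ x ∈ X d, x ∈ lines d
  lt : ∀ d < 15, ∀ x ∈ X d, x < 2 ^ 60
  ne_zero : ∀ d < 15, ∀ x ∈ X d, x ≠ 0
  exists_mem : ∀ d < 15, ∀ b, (hexFree d).testBit b = true → ∃ x ∈ X d, x.testBit b = true
  disjoint : ∀ d < 15, ∀ x ∈ X d, ∀ y ∈ X d, x ≠ y → x &&& y = 0
  sparse : ∀ d < 15, ∀ e < 15, d ≠ e → ∀ x ∈ X d, ∀ y ∈ X e, lowErase (x &&& y) = 0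

/-- Restriction to masks meeting the chosen ones at most once loses no true line, by
`System.sparse`. -/
theorem holds_meet {X : ℕ → Set ℕ} (hX : System X) {d : ℕ} (hd : d < 15) {ch : List ℕ}
    (hch : ∀ y ∈ ch, y ∈ X d) {ds : List ℕ} {bs : List Batch} (hds : ∀ e ∈ ds, e < 15 ∧ e ≠ d)
    (h : List.Forall₂ (fun e b => ∃ n, Batch.Holds b n (X e)) ds bs) :
    List.Forall₂ (fun e b => ∃ n, Batch.Holds b n (X e)) ds (meet ch bs) := by
  induction h with
  | nil => exact List.Forall₂.nil
  | @cons e b ds bs h _ ih =>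
    have he := hds e (by simp)
    refine List.Forall₂.cons ?_ (ih fun e he => hds e (by simp [he]))
    obtain ⟨n, h⟩ := h
    exact h.meet ch (fun y hy => hX.lt d hd y (hch y hy))
      (fun y hy x hx => hX.sparse e he.1 d hd he.2 x hx y (hch y hy)) (hX.ne_zero e he.1)

theorem hexFree_bounds : ∀ d < 15, hexFree d ≠ 0 ∧ hexFree d < 2 ^ 60 := by
  decide +kernel

theorem lt_of_testBit {x c : ℕ} (hx : x < 2 ^ 60) (hc : x.testBit c = true) : c < 60 := by
  by_contra hcon
  rw [Nat.testBit_lt_two_pow (hx.trans_le (Nat.pow_le_pow_right (by norm_num)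
    (not_lt.1 hcon)))] at hc
  cases hc

/-- A system provides a genuine cover at the first duad. `cover_sound` follows the search to a cover
made of members of `X d`, where the restricted batches still hold the system and induction applies.
With no duads left the search returns `false`. -/
theorem search_sound {X : ℕ → Set ℕ} (hX : System X) {ds : List ℕ} {bs : List Batch}
    (hnodup : ds.Nodup) (hds : ∀ d ∈ ds, d < 15)
    (h : List.Forall₂ (fun e b => ∃ n, Batch.Holds b n (X e)) ds bs)
    (hs : search (ds.map hexFree) bs = true) : False := by
  induction ds generalizing bs with
  | nil => cases hs
  | cons d ds ih =>
    obtain ⟨b, bs, ⟨n, a, rfl, ha, haX⟩, hbs, rfl⟩ := List.forall₂_cons_left_iff.1 h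
    have hd := hds d (by simp)
    rw [List.nodup_cons] at hnodup
    obtain ⟨h0, hlt⟩ := hexFree_bounds d hd
    obtain ⟨c, hc, hlow, -⟩ := lowBit_spec h0
    change cover (fun ch => search (ds.map hexFree) (meet ch bs)) (onesWord n) (word n a) 1000
      (onesWord n) (hexFree d) (onesWord n &&& (word n a / lowBit (hexFree d))) [] = true at hs
    have hF : onesWord n = word n fun _ => if true = true then 1 else 0 := rfl
    have hc60 := lt_of_testBit hlt hc
    refine cover_sound (X := X d) (b := c) ha (hX.disjoint d hd) hlt (hX.exists_mem d hd) ?_ 1000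
      (fun _ => true) hF (fun _ h => h) hc (fun x hx _ => ?_) (by simp) ?_ ?_ hs
    · intro ch hch hk
      refine ih hnodup.2 (fun e he => hds e (by simp [he])) ?_ hk
      exact holds_meet hX hd hch (fun e he => ⟨hds e (by simp [he]), by
        rintro rfl; exact hnodup.1 he⟩) hbs
    · obtain ⟨i, hi, rfl⟩ := haX x hx
      exact ⟨i, hi, rfl, rfl⟩
    · intro j hj
      rw [hlow, hF, testBit_options ha _ hc60] at hj
      obtain ⟨i, hi, rfl, -, hbit⟩ := hj
      exact ⟨i, hi, rfl, by intro h0; rw [h0] at hbit; simp at hbit⟩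
    · intro x hx hxc
      obtain ⟨i, hi, rfl⟩ := haX x hx
      refine ⟨i, hi, rfl, ?_⟩
      rw [hlow, hF, testBit_options ha _ hc60]
      exact ⟨i, hi, rfl, rfl, hxc⟩

/-- The flags with positions in the interval from `lo` to `hi`. -/
def chunk (lo hi : ℕ) : ℕ :=
  Nat.mul (Nat.pow 2 (Nat.mul 64 lo)) (Nat.sub (Nat.pow 2 (Nat.mul 64 (Nat.sub hi lo))) 1)

theorem testBit_chunk {lo hi i : ℕ} (h1 : lo ≤ i) (h2 : i < hi) :
    (chunk lo hi).testBit (64 * i) = true := by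
  change (2 ^ (64 * lo) * (2 ^ (64 * (hi - lo)) - 1)).testBit (64 * i) = true
  rw [Nat.testBit_two_pow_mul, Nat.testBit_two_pow_sub_one]
  simp only [Bool.and_eq_true, decide_eq_true_eq]
  omega

/-- Were `x` a line of the system, the line through the lowest hexagon outside `x` would have some
position `i` in the batch. The search over the one range containing `i` is already contradictory, so
large searches can be split. -/
theorem searchFrom_sound {X : ℕ → Set ℕ} (hX : System X) {d : ℕ} {ds : List ℕ} {b : Batch}
    {bs : List Batch} (hnodup : (d :: ds).Nodup) (hds : ∀ e ∈ d :: ds, e < 15) {n : ℕ}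
    (hb : b.Holds n (X d))
    (hbs : List.Forall₂ (fun e b => ∃ n, Batch.Holds b n (X e)) ds bs) {x : ℕ}
    (hx : x &&& hexFree d = x) (hx' : hexFree d ^^^ x ≠ 0)
    (hs : ∀ i < n, ∃ lo hi, lo ≤ i ∧ i < hi ∧
      searchFrom (hexFree d) (ds.map hexFree) x (chunk lo hi) b bs = true) : x ∉ X d := by
  intro hxX
  obtain ⟨a, rfl, ha, haX⟩ := hb
  have hd := hds d (by simp)
  rw [List.nodup_cons] at hnodup
  obtain ⟨h0, hlt⟩ := hexFree_bounds d hd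
  have hx60 := hX.lt d hd x hxX
  have hbits : ∀ c, (hexFree d ^^^ x).testBit c = ((hexFree d).testBit c && !x.testBit c) := by
    intro c
    have := congrArg (fun y => y.testBit c) hx
    simp only [Nat.testBit_and] at this
    rw [Nat.testBit_xor, ← this]
    cases (hexFree d).testBit c <;> simp
  obtain ⟨c, hc, hlow, -⟩ := lowBit_spec hx'
  have hcU : (hexFree d).testBit c = true := by
    rw [hbits] at hc
    exact (Bool.and_eq_true_iff.1 hc).1
  have hc60 := lt_of_testBit hlt hcU
  have hF : disjointFields (onesWord n) (word n a) x =
      word n fun i => if decide (a i &&& x = 0) = true then 1 else 0 := by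
    rw [disjointFields_word (fun i hi => (ha i hi).trans (by norm_num)) (hx60.trans (by norm_num))]
    refine word_congr fun i _ => ?_
    by_cases h : a i &&& x = 0 <;> simp [h]
  have hp : ∀ y ∈ X d, y &&& (hexFree d ^^^ x) ≠ 0 →
      ∃ i < n, a i = y ∧ decide (a i &&& x = 0) = true := by
    intro y hy hne
    obtain ⟨e, he⟩ := Nat.exists_testBit_of_ne_zero hne
    rw [Nat.testBit_and, hbits] at he
    simp only [Bool.and_eq_true, Bool.not_eq_true'] at he
    obtain ⟨i, hi, rfl⟩ := haX y hy
    have hne : a i ≠ x := by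
      intro h0; rw [h0] at he; rw [he.2.2] at he; simp at he
    exact ⟨i, hi, rfl, by simpa using hX.disjoint d hd _ hy _ hxX hne⟩
  obtain ⟨y, hyX, hyc⟩ := hX.exists_mem d hd c hcU
  obtain ⟨i, hi, rfl, hpi⟩ := hp y hyX (by
    intro h0
    have : (y &&& (hexFree d ^^^ x)).testBit c = true := by rw [Nat.testBit_and, hyc, hc]; rfl
    rw [h0] at this; simp at this)
  obtain ⟨lo, hi', hlo, hhi, hs⟩ := hs i hi
  change cover (fun ch => search (ds.map hexFree) (meet ch bs)) (onesWord n) (word n a) 1000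
    (disjointFields (onesWord n) (word n a) x) (hexFree d ^^^ x)
    (chunk lo hi' &&& (disjointFields (onesWord n) (word n a) x &&&
      (word n a / lowBit (hexFree d ^^^ x)))) [x] = true at hs
  refine cover_sound (X := X d) (b := c) ha (hX.disjoint d hd) hlt (hX.exists_mem d hd) ?_ 1000
    (fun i => decide (a i &&& x = 0)) hF (fun e he => ?_) hc hp (by simpa using hxX) ?_ ?_ hs
  · intro ch hch hk
    refine search_sound hX hnodup.2 (fun e he => hds e (by simp [he])) ?_ hk
    exact holds_meet hX hd hch (fun e he => ⟨hds e (by simp [he]), by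
      rintro rfl; exact hnodup.1 he⟩) hbs
  · rw [hbits] at he
    exact (Bool.and_eq_true_iff.1 he).1
  · intro j hj
    rw [Nat.testBit_and, Bool.and_eq_true, hlow, hF, testBit_options ha _ hc60] at hj
    obtain ⟨-, i, hi, rfl, -, hbit⟩ := hj
    exact ⟨i, hi, rfl, by intro h0; rw [h0] at hbit; simp at hbit⟩
  · intro y hy hyc'
    -- Restricting the options to one range loses nothing: by disjointness only one member of `X d`
    -- contains `c`.
    have hya : y = a i := by
      by_contra hne
      have h1 := hX.disjoint d hd _ hy _ hyX hne
      have : (y &&& a i).testBit c = true := by rw [Nat.testBit_and, hyc', hyc]; rfl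
      rw [h1] at this; simp at this
    refine ⟨i, hi, hya.symm, ?_⟩
    rw [Nat.testBit_and, testBit_chunk hlo hhi, Bool.true_and, hlow, hF, testBit_options ha _ hc60]
    exact ⟨i, hi, rfl, hpi, hyc⟩

theorem holds_candidates {X : ℕ → Set ℕ} (hX : System X) {ex : List (ℕ × ℕ)}
    (hex : ∀ e ∈ ex, e.2 < 2 ^ 60 ∧ e.2 ∉ X e.1) {d : ℕ} (hd : d < 15)
    (hl : ∀ x ∈ lines d, x < 2 ^ 60) : (candidates ex d).Holds (lines d).length (X d) := by
  induction ex with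
  | nil => exact (holds_pack _ hl).mono (hX.mem_lines d hd)
  | cons e ex ih =>
    have ih := ih fun e he => hex e (by simp [he])
    obtain ⟨h60, hne⟩ := hex e (by simp)
    change (Bool.rec (candidates ex d) ((candidates ex d).map (erasePart · e.2 ·))
      (Nat.beq e.1 d) : Batch).Holds _ _
    cases h : Nat.beq e.1 d
    · exact ih
    · rw [Nat.eq_of_beq_eq_true h] at hne
      exact ih.erasePart h60 hne

theorem refute_sound {X : ℕ → Set ℕ} (hX : System X) {ex : List (ℕ × ℕ)}
    (hex : ∀ e ∈ ex, e.2 < 2 ^ 60 ∧ e.2 ∉ X e.1)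
    (hl : ∀ d < 15, ∀ x ∈ lines d, x < 2 ^ 60) {x : ℕ}
    (hx : x &&& hexFree 0 = x) (hx' : hexFree 0 ^^^ x ≠ 0)
    (hs : ∀ i < (lines 0).length, ∃ lo hi, lo ≤ i ∧ i < hi ∧ refute ex x (chunk lo hi) = true) :
    x ∉ X 0 :=
  have h (d) (hd : d < 15) := holds_candidates hX hex hd (hl d hd)
  -- Positions 0, 9, 14 are the duads {0, 1}, {2, 3}, {4, 5} of one syntheme; position 10 is {2, 4}.
  searchFrom_sound (ds := [9, 14, 10]) hX (by decide) (by decide) (h 0 (by decide))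
    (.cons ⟨_, h 9 (by decide)⟩ (.cons ⟨_, h 14 (by decide)⟩ (.cons ⟨_, h 10 (by decide)⟩ .nil)))
    hx hx' hs

end PlaneCode

/-! ### Masks as finite sets, and completeness of the list of candidate lines -/

namespace PlaneCode

/-- The number whose binary digits are ones exactly at the positions in `U`. -/
def mask (U : Finset ℕ) : ℕ := ∑ i ∈ U, 2 ^ i

theorem testBit_mask (U : Finset ℕ) (i : ℕ) : (mask U).testBit i = true ↔ i ∈ U := by
  have h := Finset.toFinset_bitIndices_sum_two_pow U
  rw [← Nat.mem_bitIndices, ← List.mem_toFinset]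
  exact (Finset.ext_iff.1 h) i

theorem eq_mask {x : ℕ} {U : Finset ℕ} (h : ∀ i, x.testBit i = true ↔ i ∈ U) : x = mask U := by
  refine Nat.eq_of_testBit_eq fun i => Bool.eq_iff_iff.2 ?_
  rw [h, testBit_mask]

theorem mask_injective : Function.Injective mask := fun U V h => by
  ext i
  rw [← testBit_mask, h, testBit_mask]

theorem mask_lt {U : Finset ℕ} {n : ℕ} (hU : ∀ i ∈ U, i < n) : mask U < 2 ^ n := by
  refine Nat.lt_pow_two_of_testBit _ fun i hi => ?_
  rw [← Bool.not_eq_true, testBit_mask]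
  exact fun h => absurd (hU i h) (by omega)

theorem exists_eq_mask {x n : ℕ} (hx : x < 2 ^ n) :
    ∃ U : Finset ℕ, (∀ i ∈ U, i < n) ∧ x = mask U := by
  refine ⟨(Finset.range n).filter fun i => x.testBit i = true,
    fun i hi => Finset.mem_range.1 (Finset.mem_filter.1 hi).1, eq_mask fun i => ?_⟩
  simp only [Finset.mem_filter, Finset.mem_range, iff_and_self]
  intro h
  by_contra hcon
  rw [Nat.testBit_lt_two_pow (hx.trans_le (Nat.pow_le_pow_right (by norm_num)
    (not_lt.1 hcon)))] at h
  cases h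

theorem mask_land (U V : Finset ℕ) : mask U &&& mask V = mask (U ∩ V) :=
  eq_mask fun i => by
    rw [Nat.testBit_and, Bool.and_eq_true, testBit_mask, testBit_mask, Finset.mem_inter]

theorem mask_empty : mask ∅ = 0 := rfl

theorem mask_eq_zero {U : Finset ℕ} : mask U = 0 ↔ U = ∅ := by
  rw [← mask_empty, mask_injective.eq_iff]

theorem lowBit_mask {U : Finset ℕ} (hU : U.Nonempty) :
    ∃ j ∈ U, lowBit (mask U) = 2 ^ j ∧ lowErase (mask U) = mask (U.erase j) := by
  obtain ⟨j, hj, hlow, herase⟩ := lowBit_spec (M := mask U) (by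
    rw [Ne, mask_eq_zero]; exact hU.ne_empty)
  refine ⟨j, (testBit_mask _ _).1 hj, hlow, eq_mask fun i => ?_⟩
  rw [herase, Bool.and_eq_true, testBit_mask, decide_eq_true_eq, Finset.mem_erase, and_comm]

theorem lowErase_mask_eq_zero {U : Finset ℕ} (hU : U.card ≤ 1) : lowErase (mask U) = 0 := by
  rcases U.eq_empty_or_nonempty with rfl | h
  · rfl
  · obtain ⟨j, hj, -, he⟩ := lowBit_mask h
    rw [he, mask_eq_zero, ← Finset.card_eq_zero, Finset.card_erase_of_mem hj]
    omega

/-- The pair of synthemes of a hexagon. -/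
def hexagon (b : ℕ) : ℕ × ℕ := hexagons.getD b (0, 0)

/-- The duad at position `d` belongs to the syntheme at position `s`. -/
def InSyntheme (d s : ℕ) : Prop := contains d (synthemes.getD s []) = true

instance (d s : ℕ) : Decidable (InSyntheme d s) := inferInstanceAs (Decidable (_ = true))

/-- The syntheme at position `s` is one of the two of the hexagon at position `b`. -/
def InHexagon (s b : ℕ) : Prop := (hexagon b).1 = s ∨ (hexagon b).2 = s

instance (s b : ℕ) : Decidable (InHexagon s b) := inferInstanceAs (Decidable (_ ∨ _))

theorem hexagon_lt : ∀ b < 60, (hexagon b).1 < (hexagon b).2 ∧ (hexagon b).2 < 15 := by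
  decide +kernel

theorem span_eq_mask {b : ℕ} (hb : b < 60) :
    span (hexagon b) = mask {(hexagon b).1, (hexagon b).2} := by
  unfold mask
  rw [Finset.sum_pair (hexagon_lt b hb).1.ne]
  rfl

theorem testBit_span {b : ℕ} (hb : b < 60) (s : ℕ) :
    (span (hexagon b)).testBit s = true ↔ InHexagon s b := by
  rw [span_eq_mask hb, testBit_mask]
  simp [InHexagon, eq_comm]

theorem free_spec : ∀ d < 15, free d < 2 ^ 15 ∧
    ∀ s < 15, ((free d).testBit s = true ↔ ¬ InSyntheme d s) := by
  decide +kernel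

theorem hexFree_spec : ∀ d < 15, ∀ b < 60, ((hexFree d).testBit b = true ↔
    ¬ InSyntheme d (hexagon b).1 ∧ ¬ InSyntheme d (hexagon b).2) := by
  decide +kernel

theorem options_cons (s : ℕ) (h : ℕ × ℕ) (l : List (ℕ × ℕ)) (v : ℕ) :
    options s (h :: l) v =
      if h.1 = s then (span h, v) :: options s l (2 * v) else options s l (2 * v) := by
  change (cond (Nat.beq h.1 s) ((span h, v) :: options s l (2 * v)) (options s l (2 * v)))
    = _
  cases hb : Nat.beq h.1 s
  · rw [if_neg (Nat.ne_of_beq_eq_false hb)]; rfl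
  · rw [if_pos (Nat.eq_of_beq_eq_true hb)]; rfl

theorem mem_options (s : ℕ) (l : List (ℕ × ℕ)) (v i : ℕ) (hi : i < l.length)
    (hs : (l.getD i (0, 0)).1 = s) : (span (l.getD i (0, 0)), v * 2 ^ i) ∈ options s l v := by
  induction l generalizing v i with
  | nil => simp at hi
  | cons h l ih =>
    rw [options_cons]
    cases i with
    | zero =>
      rw [List.getD_cons_zero] at hs ⊢
      rw [if_pos hs]
      simp
    | succ i =>
      rw [List.getD_cons_succ] at hs ⊢
      have := ih (2 * v) i (by simpa using hi) hs
      rw [show v * 2 ^ (i + 1) = 2 * v * 2 ^ i by ring]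
      split_ifs
      · exact List.mem_cons_of_mem _ this
      · exact this

theorem covers_cons (e : ℕ × List (ℕ × ℕ)) (tab : List (ℕ × List (ℕ × ℕ))) (unc acc : ℕ)
    (rest : List ℕ) :
    covers (e :: tab) unc acc rest = if unc &&& e.1 = 0 then covers tab unc acc rest else
      e.2.foldr (fun q r => if unc &&& q.1 = q.1 then covers tab (unc ^^^ q.1) (acc + q.2) r else r)
        rest := by
  obtain ⟨m, opts⟩ := e
  change (Bool.rec (List.rec rest (fun q _ ih' => Bool.rec ih'
      (covers tab (unc ^^^ q.1) (acc + q.2) ih') (Nat.beq (unc &&& q.1) q.1)) opts)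
      (covers tab unc acc rest) (Nat.beq (unc &&& m) 0) : List ℕ) = _
  cases hb : Nat.beq (unc &&& m) 0
  · rw [if_neg (Nat.ne_of_beq_eq_false hb)]
    dsimp only
    induction opts with
    | nil => rfl
    | cons q opts ih =>
      rw [List.foldr_cons, ← ih]
      dsimp only
      cases hq : Nat.beq (unc &&& q.1) q.1
      · rw [if_neg (Nat.ne_of_beq_eq_false hq)]
      · rw [if_pos (Nat.eq_of_beq_eq_true hq)]
  · rw [if_pos (Nat.eq_of_beq_eq_true hb)]

theorem mem_covers_of_mem (tab : List (ℕ × List (ℕ × ℕ))) (unc acc : ℕ) (rest : List ℕ) {y : ℕ}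
    (hy : y ∈ rest) : y ∈ covers tab unc acc rest := by
  induction tab generalizing unc acc rest with
  | nil => exact List.mem_cons_of_mem _ hy
  | cons e tab ih =>
    rw [covers_cons]
    split_ifs
    · exact ih _ _ _ hy
    · induction e.2 with
      | nil => exact hy
      | cons q l ih' =>
        rw [List.foldr_cons]
        split_ifs
        · exact ih _ _ _ ih'
        · exact ih'

theorem mem_foldr_covers (tab : List (ℕ × List (ℕ × ℕ))) (unc acc : ℕ) (rest : List ℕ)
    (opts : List (ℕ × ℕ)) {q : ℕ × ℕ} (hq : q ∈ opts) (hqu : unc &&& q.1 = q.1) {y : ℕ}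
    (hy : ∀ r, y ∈ covers tab (unc ^^^ q.1) (acc + q.2) r) :
    y ∈ opts.foldr (fun q r => if unc &&& q.1 = q.1 then
      covers tab (unc ^^^ q.1) (acc + q.2) r else r) rest := by
  induction opts with
  | nil => simp at hq
  | cons p opts ih =>
    rw [List.foldr_cons]
    rcases List.mem_cons.1 hq with rfl | hq
    · rw [if_pos hqu]
      exact hy _
    · split_ifs
      · exact mem_covers_of_mem _ _ _ _ (ih hq)
      · exact ih hq

/-- Induction on the synthemes in increasing order: the hexagon of `T` through the lowest uncovered
syntheme is one of the listed options, and removing it leaves an exact cover of the rest. -/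
theorem mem_covers (ss : List ℕ) (hss : ss.Pairwise (· < ·)) {unc acc : ℕ} (rest : List ℕ)
    {T : Finset ℕ} (hT : ∀ b ∈ T, b < 60) (hunc : ∀ s, unc.testBit s = true → s ∈ ss)
    (hTunc : ∀ b ∈ T, ∀ s, InHexagon s b → unc.testBit s = true)
    (hex : ∀ s, unc.testBit s = true → ∃ b ∈ T, InHexagon s b)
    (huniq : ∀ s, ∀ b ∈ T, ∀ b' ∈ T, InHexagon s b → InHexagon s b' → b = b') :
    acc + mask T ∈ covers (ss.map fun s => (2 ^ s, options s hexagons 1)) unc acc rest := by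
  induction ss generalizing unc acc rest T with
  | nil =>
    have : T = ∅ := by
      refine Finset.eq_empty_of_forall_notMem fun b hb => ?_
      simpa using hunc _ (hTunc b hb _ (Or.inl rfl))
    subst this
    exact List.mem_cons_self
  | cons s ss ih =>
    rw [List.pairwise_cons] at hss
    rw [List.map_cons, covers_cons]
    dsimp only
    rw [Nat.and_two_pow]
    have hmem : ∀ t, unc.testBit t = true → t ≠ s → t ∈ ss := fun t ht hne =>
      (List.mem_cons.1 (hunc t ht)).resolve_left hne
    cases hbit : unc.testBit s
    · rw [if_pos (by simp)]
      refine ih hss.2 rest hT (fun t ht => hmem t ht ?_) hTunc hex huniq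
      rintro rfl
      rw [hbit] at ht; cases ht
    · rw [if_neg (by simp)]
      obtain ⟨b, hbT, hb⟩ := hex s hbit
      have hb60 := hT b hbT
      -- Otherwise the first syntheme of `b` would be uncovered and later in the list, hence larger
      -- than `s`, the second one.
      have hfirst : (hexagon b).1 = s := by
        rcases hb with h | h
        · exact h
        · by_contra hne
          have h1 := hss.1 _ (hmem _ (hTunc b hbT _ (Or.inl rfl)) hne)
          have h2 := (hexagon_lt b hb60).1
          omega
      have hopt : (span (hexagon b), 2 ^ b) ∈ options s hexagons 1 := by
        simpa [hexagon] using mem_options s hexagons 1 b hb60 hfirst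
      have hbits : ∀ t, (unc ^^^ span (hexagon b)).testBit t = true ↔
          unc.testBit t = true ∧ ¬ InHexagon t b := by
        intro t
        have h1 := testBit_span hb60 t
        have h2 := hTunc b hbT t
        rw [Nat.testBit_xor]
        rw [← h1] at h2 ⊢
        cases h3 : (span (hexagon b)).testBit t <;> cases h4 : unc.testBit t <;> simp_all
      refine mem_foldr_covers _ _ _ _ _ hopt ?_ fun r => ?_
      · refine Nat.eq_of_testBit_eq fun t => Bool.eq_iff_iff.2 ?_
        rw [Nat.testBit_and, Bool.and_eq_true, testBit_span hb60, and_iff_right_iff_imp]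
        exact hTunc b hbT t
      · have hsum : acc + mask T = acc + 2 ^ b + mask (T.erase b) := by
          unfold mask
          rw [← Finset.add_sum_erase T _ hbT, add_assoc]
        rw [hsum]
        refine ih hss.2 r (fun c hc => hT c (Finset.mem_of_mem_erase hc)) (fun t ht => ?_)
          (fun c hc t ht => ?_) (fun t ht => ?_) fun t c hc c' hc' h h' =>
            huniq t c (Finset.mem_of_mem_erase hc) c' (Finset.mem_of_mem_erase hc') h h'
        · rw [hbits] at ht
          exact hmem t ht.1 (by rintro rfl; exact ht.2 hb)
        · rw [Finset.mem_erase] at hc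
          exact (hbits t).2 ⟨hTunc c hc.2 t ht, fun h => hc.1 (huniq t c hc.2 b hbT ht h)⟩
        · rw [hbits] at ht
          obtain ⟨c, hc, h⟩ := hex t ht.1
          exact ⟨c, Finset.mem_erase.2 ⟨by rintro rfl; exact ht.2 h, hc⟩, h⟩

/-- Every exact cover of the synthemes free of a duad by hexagons is listed. -/
theorem mask_mem_lines {d : ℕ} (hd : d < 15) {T : Finset ℕ} (hT : ∀ b ∈ T, b < 60)
    (hfree : ∀ b ∈ T, ∀ s, InHexagon s b → ¬ InSyntheme d s)
    (hex : ∀ s < 15, ¬ InSyntheme d s → ∃ b ∈ T, InHexagon s b)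
    (huniq : ∀ s, ∀ b ∈ T, ∀ b' ∈ T, InHexagon s b → InHexagon s b' → b = b') :
    mask T ∈ lines d := by
  obtain ⟨hlt, hbit⟩ := free_spec d hd
  have hlt15 : ∀ s, (free d).testBit s = true → s < 15 := by
    intro s hs
    by_contra hcon
    rw [Nat.testBit_lt_two_pow (hlt.trans_le (Nat.pow_le_pow_right (by norm_num)
      (not_lt.1 hcon)))] at hs
    cases hs
  have h := mem_covers (List.range 15) List.pairwise_lt_range (unc := free d) (acc := 0) [] hT
    (fun s hs => List.mem_range.2 (hlt15 s hs)) (fun b hb s hs => ?_)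
    (fun s hs => hex s (hlt15 s hs) ((hbit s (hlt15 s hs)).1 hs)) huniq
  · rw [zero_add] at h
    exact h
  · have h15 : s < 15 := by
      have := hexagon_lt b (hT b hb)
      rcases hs with h | h <;> omega
    exact (hbit s h15).2 (hfree b hb s hs)

end PlaneCode

/-! ### Relabelling by adjacent transpositions, and excluded orbits -/

namespace PlaneCode

/-- The image of the hexagon `b` under the `k`-th adjacent transposition. -/
def hexImage (k b : ℕ) : ℕ := nth (hexSwap.getD k []) b

/-- The image of the duad `d` under the `k`-th adjacent transposition. -/
def duadImage (k d : ℕ) : ℕ := nth (duadSwap.getD k []) d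

/-- The image of the syntheme `s` under the `k`-th adjacent transposition. -/
def synthemeImage (k s : ℕ) : ℕ := nth (synthemeSwap.getD k []) s

/-- The last clause is the table lookup of `permute`: the table has base 64, and the sixth power of
`2 ^ b` is `64 ^ b`, so a digit is found from the bit itself without a logarithm. -/
theorem hexImage_spec : ∀ k < 5, ∀ b < 60, hexImage k b < 60 ∧ hexImage k (hexImage k b) = b ∧
    Nat.land (Nat.div (packNat 64 (hexSwap.getD k [])) (Nat.pow (Nat.pow 2 b) 6)) 63 =
      hexImage k b := by
  decide +kernel

theorem duadImage_spec : ∀ k < 5, ∀ d < 15,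
    duadImage k d < 15 ∧ duadImage k (duadImage k d) = d := by
  decide +kernel

theorem permute_succ (T n x acc : ℕ) : permute T (n + 1) x acc =
    if x = 0 then acc else permute T n (lowErase x)
      (acc + 2 ^ Nat.land (Nat.div T (Nat.pow (lowBit x) 6)) 63) := by
  rcases x with _ | x
  · rfl
  · rw [if_neg (by omega)]; rfl

theorem permute_mask {k : ℕ} (hk : k < 5) (n : ℕ) {U : Finset ℕ} (hU : ∀ b ∈ U, b < 60)
    (hn : U.card ≤ n) (acc : ℕ) :
    permute (packNat 64 (hexSwap.getD k [])) n (mask U) acc = acc + ∑ b ∈ U, 2 ^ hexImage k b := by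
  induction n generalizing U acc with
  | zero =>
    obtain rfl := Finset.card_eq_zero.1 (Nat.le_zero.1 hn)
    rfl
  | succ n ih =>
    rw [permute_succ]
    rcases U.eq_empty_or_nonempty with rfl | h
    · simp [mask_empty]
    · rw [if_neg (by rw [mask_eq_zero]; exact h.ne_empty)]
      obtain ⟨j, hj, hlow, he⟩ := lowBit_mask h
      have hc := Finset.card_erase_of_mem hj
      rw [he, hlow, ih (fun b hb => hU b (Finset.mem_of_mem_erase hb)) (by omega)]
      have hjk : Nat.land (Nat.div (packNat 64 (hexSwap.getD k [])) (Nat.pow (2 ^ j) 6)) 63 =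
          hexImage k j := (hexImage_spec k hk j (hU j hj)).2.2
      rw [hjk, ← Finset.add_sum_erase U _ hj, add_assoc]

theorem hexImage_injOn {k : ℕ} (hk : k < 5) {b c : ℕ} (hb : b < 60) (hc : c < 60)
    (h : hexImage k b = hexImage k c) : b = c := by
  rw [← (hexImage_spec k hk b hb).2.1, h, (hexImage_spec k hk c hc).2.1]

theorem act_mask {k : ℕ} (hk : k < 5) (d : ℕ) {U : Finset ℕ} (hU : ∀ b ∈ U, b < 60) :
    act k (d, mask U) = (duadImage k d, mask (U.image (hexImage k))) := by
  have hcard : U.card ≤ 60 := by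
    have := Finset.card_le_card (show U ⊆ Finset.range 60 from
      fun b hb => Finset.mem_range.2 (hU b hb))
    simpa using this
  change (duadImage k d, permute _ 60 (mask U) 0) = _
  rw [permute_mask hk 60 hU hcard, zero_add, mask,
    Finset.sum_image fun b hb c hc h => hexImage_injOn hk (hU b hb) (hU c hc) h]

theorem act_act {k : ℕ} (hk : k < 5) {q : ℕ × ℕ} (hd : q.1 < 15) (hx : q.2 < 2 ^ 60) :
    (act k q).1 < 15 ∧ (act k q).2 < 2 ^ 60 ∧ act k (act k q) = q := by
  obtain ⟨d, x⟩ := q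
  obtain ⟨U, hU, rfl⟩ := exists_eq_mask hx
  have hU' : ∀ b ∈ U.image (hexImage k), b < 60 := by
    intro b hb
    obtain ⟨c, hc, rfl⟩ := Finset.mem_image.1 hb
    exact (hexImage_spec k hk c (hU c hc)).1
  have himage : (U.image (hexImage k)).image (hexImage k) = U := by
    rw [Finset.image_image]
    conv_rhs => rw [← Finset.image_id (s := U)]
    exact Finset.image_congr fun b hb => (hexImage_spec k hk b (hU b hb)).2.1
  rw [act_mask hk d hU]
  refine ⟨(duadImage_spec k hk d hd).1, mask_lt hU', ?_⟩
  rw [act_mask hk _ hU', himage, (duadImage_spec k hk d hd).2]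

theorem orbitStep_induction {Q : ℕ × ℕ → Prop} (hQ : ∀ k < 5, ∀ q, Q q → Q (act k q)) (k : ℕ)
    (hk : k ≤ 5) {l : List (ℕ × ℕ)} (hl : ∀ q ∈ l, Q q) : ∀ q ∈ orbitStep k l, Q q := by
  induction k generalizing l with
  | zero => exact hl
  | succ k ih =>
    intro q hq
    change q ∈ l ++ orbitStep k (l.map (act k)) at hq
    rcases List.mem_append.1 hq with hq | hq
    · exact hl q hq
    · refine ih (by omega) (fun r hr => ?_) q hq
      obtain ⟨p, hp, rfl⟩ := List.mem_map.1 hr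
      exact hQ k (by omega) p (hl p hp)

theorem orbit_induction {Q : ℕ × ℕ → Prop} (hQ : ∀ k < 5, ∀ q, Q q → Q (act k q)) {p : ℕ × ℕ}
    (hp : Q p) : ∀ q ∈ orbit p, Q q := by
  have h (k) (hk : k ≤ 5) {l} := orbitStep_induction hQ k hk (l := l)
  exact h 5 le_rfl (h 4 (by omega) (h 3 (by omega) (h 2 (by omega) (h 1 (by omega) (by simpa)))))

/-- A class of systems that is stable under the relabellings by adjacent transpositions. -/
structure StableClass (C : Set (ℕ → Set ℕ)) : Prop where
  system : ∀ X ∈ C, System X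
  stable : ∀ X ∈ C, ∀ k < 5, ∃ Y ∈ C, ∀ d < 15, ∀ x ∈ X d, (act k (d, x)).2 ∈ Y (act k (d, x)).1

/-- The mask `q.2` belongs to the duad `q.1` in no system of the class. -/
def Excluded (C : Set (ℕ → Set ℕ)) (q : ℕ × ℕ) : Prop :=
  q.1 < 15 ∧ q.2 < 2 ^ 60 ∧ ∀ X ∈ C, q.2 ∉ X q.1

/-- If the image occurred in a system of the class, the same transposition, an involution, would
carry it back to `q` in another system of the class. -/
theorem Excluded.act {C : Set (ℕ → Set ℕ)} (hC : StableClass C) (k : ℕ) (hk : k < 5) (q : ℕ × ℕ)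
    (hq : Excluded C q) : Excluded C (act k q) := by
  obtain ⟨h1, h2, h3⟩ := hq
  obtain ⟨ha, hb, hc⟩ := act_act hk h1 h2
  refine ⟨ha, hb, fun X hX hmem => ?_⟩
  obtain ⟨Y, hY, h⟩ := hC.stable X hX k hk
  have := h _ ha _ hmem
  rw [Prod.mk.eta, hc] at this
  exact h3 Y hY this

theorem Excluded.orbit {C : Set (ℕ → Set ℕ)} (hC : StableClass C) {p : ℕ × ℕ} (hp : Excluded C p) :
    ∀ q ∈ orbit p, Excluded C q :=
  orbit_induction (Excluded.act hC) hp

/-- The pairs in the orbits of the given masks at the first duad. -/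
def orbits (l : List ℕ) : List (ℕ × ℕ) := l.flatMap fun x => orbit (0, x)

theorem Excluded.orbits {C : Set (ℕ → Set ℕ)} (hC : StableClass C) {l : List ℕ}
    (hl : ∀ x ∈ l, Excluded C (0, x)) : ∀ q ∈ orbits l, Excluded C q := by
  intro q hq
  obtain ⟨x, hx, hq⟩ := List.mem_flatMap.1 hq
  exact (hl x hx).orbit hC q hq

theorem lines_lt : ∀ d < 15, ∀ x ∈ lines d, x < 2 ^ 60 := by
  decide +kernel

theorem length_lines_zero : (lines 0).length = 344 := by
  decide +kernel

/-- The orbits of earlier exclusions contain pairs at all duads, so they shorten the candidate lists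
at all four duads searched. -/
theorem Excluded.of_refute {C : Set (ℕ → Set ℕ)} (hC : StableClass C) {l : List ℕ}
    (hl : ∀ x ∈ l, Excluded C (0, x)) {x : ℕ} (hx : x &&& hexFree 0 = x)
    (hx' : hexFree 0 ^^^ x ≠ 0)
    (hs : ∀ i < 344, ∃ lo hi, lo ≤ i ∧ i < hi ∧
      refute (PlaneCode.orbits l) x (chunk lo hi) = true) :
    Excluded C (0, x) := by
  refine ⟨by norm_num, ?_, fun X hX => ?_⟩
  · rw [← hx]
    exact Nat.and_lt_two_pow _ (hexFree_bounds 0 (by norm_num)).2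
  · refine refute_sound (hC.system X hX) (fun e he => ?_) lines_lt hx hx'
      (length_lines_zero ▸ hs)
    have h := Excluded.orbits hC hl e he
    exact ⟨h.2.1, h.2.2 X hX⟩

end PlaneCode

/-! ### The computation: exclusion of nine orbits -/

namespace PlaneCode

section
set_option maxRecDepth 1000000

/-- Boolean membership test in a list of pairs. -/
noncomputable def listed (l : List (ℕ × ℕ)) (d x : ℕ) : Bool :=
  List.rec false
    (fun q _ ih => Bool.rec ih (Bool.rec ih true (Nat.beq q.1 d)) (Nat.beq q.2 x)) l

/-- All members of `l` that contain the mask `m` are in the orbits of the representatives. -/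
noncomputable def allListed (m d : ℕ) (l : List ℕ) : Bool :=
  List.rec true
    (fun x _ ih => Bool.rec ih (Bool.rec false ih (listed (orbits reps) d x))
      (Nat.beq (Nat.land x m) m)) l

theorem mem_of_listed {l : List (ℕ × ℕ)} {d x : ℕ} (h : listed l d x = true) : (d, x) ∈ l := by
  induction l with
  | nil => cases h
  | cons q l ih =>
    change (Bool.rec (listed l d x) (Bool.rec (listed l d x) true (Nat.beq q.1 d))
      (Nat.beq q.2 x) : Bool) = true at h
    cases h2 : Nat.beq q.2 x <;> rw [h2] at h
    · exact List.mem_cons_of_mem _ (ih h)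
    · cases h1 : Nat.beq q.1 d <;> rw [h1] at h
      · exact List.mem_cons_of_mem _ (ih h)
      · rw [← Nat.eq_of_beq_eq_true h1, ← Nat.eq_of_beq_eq_true h2]
        exact List.mem_cons_self

theorem mem_orbits_of_allListed {m d : ℕ} {l : List ℕ} (h : allListed m d l = true) {x : ℕ}
    (hx : x ∈ l) (hm : x &&& m = m) : (d, x) ∈ orbits reps := by
  induction l with
  | nil => simp at hx
  | cons y l ih =>
    change (Bool.rec (allListed m d l) (Bool.rec false (allListed m d l)
      (listed (orbits reps) d y)) (Nat.beq (y &&& m) m) : Bool) = true at h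
    cases h1 : Nat.beq (y &&& m) m <;> rw [h1] at h
    · rcases List.mem_cons.1 hx with rfl | hx
      · exact absurd hm (Nat.ne_of_beq_eq_false h1)
      · exact ih h hx
    · cases h2 : listed (orbits reps) d y <;> rw [h2] at h
      · cases h
      · rcases List.mem_cons.1 hx with rfl | hx
        · exact mem_of_listed h2
        · exact ih h hx

/-- For the first representative nothing is erased yet, and the search is divided by the position of
the second line among the 344 candidates. -/
theorem refute_rep_0_0_80 :
    refute (orbits (reps.take 0)) (nth reps 0) (chunk 0 80) = true := by
  decide +kernel

theorem refute_rep_0_80_110 :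
    refute (orbits (reps.take 0)) (nth reps 0) (chunk 80 110) = true := by
  decide +kernel

theorem refute_rep_0_110_140 :
    refute (orbits (reps.take 0)) (nth reps 0) (chunk 110 140) = true := by
  decide +kernel

theorem refute_rep_0_140_180 :
    refute (orbits (reps.take 0)) (nth reps 0) (chunk 140 180) = true := by
  decide +kernel

theorem refute_rep_0_180_230 :
    refute (orbits (reps.take 0)) (nth reps 0) (chunk 180 230) = true := by
  decide +kernel

theorem refute_rep_0_230_344 :
    refute (orbits (reps.take 0)) (nth reps 0) (chunk 230 344) = true := by
  decide +kernel

theorem refute_rep_1_0_110 :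
    refute (orbits (reps.take 1)) (nth reps 1) (chunk 0 110) = true := by
  decide +kernel

theorem refute_rep_1_110_180 :
    refute (orbits (reps.take 1)) (nth reps 1) (chunk 110 180) = true := by
  decide +kernel

theorem refute_rep_1_180_344 :
    refute (orbits (reps.take 1)) (nth reps 1) (chunk 180 344) = true := by
  decide +kernel

theorem refute_rep_2 :
    refute (orbits (reps.take 2)) (nth reps 2) (chunk 0 344) = true := by
  decide +kernel

theorem refute_rep_3 :
    refute (orbits (reps.take 3)) (nth reps 3) (chunk 0 344) = true := by
  decide +kernel

theorem refute_rep_4 :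
    refute (orbits (reps.take 4)) (nth reps 4) (chunk 0 344) = true := by
  decide +kernel

theorem refute_rep_5 :
    refute (orbits (reps.take 5)) (nth reps 5) (chunk 0 344) = true := by
  decide +kernel

theorem refute_rep_6 :
    refute (orbits (reps.take 6)) (nth reps 6) (chunk 0 344) = true := by
  decide +kernel

theorem refute_rep_7 :
    refute (orbits (reps.take 7)) (nth reps 7) (chunk 0 344) = true := by
  decide +kernel

theorem refute_rep_8 :
    refute (orbits (reps.take 8)) (nth reps 8) (chunk 0 344) = true := by
  decide +kernel

/-- The mask is `2 ^ 25 + 2 ^ 31`. Excluding all candidates through a single pair of points is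
enough, since that pair is joined by a line. -/
theorem allListed_lines : ∀ d < 15, allListed 2181038080 d (lines d) = true := by
  decide +kernel

end

theorem reps_spec : ∀ i < 9,
    nth reps i &&& hexFree 0 = nth reps i ∧ hexFree 0 ^^^ nth reps i ≠ 0 := by
  decide +kernel

theorem exists_refute : ∀ i < 9, ∀ j < 344, ∃ lo hi, lo ≤ j ∧ j < hi ∧
    refute (orbits (reps.take i)) (nth reps i) (chunk lo hi) = true := by
  intro i hi j hj
  interval_cases i
  · rcases lt_or_ge j 80 with h | h
    · exact ⟨0, 80, by omega, h, refute_rep_0_0_80⟩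
    rcases lt_or_ge j 110 with h | h
    · exact ⟨80, 110, by omega, h, refute_rep_0_80_110⟩
    rcases lt_or_ge j 140 with h | h
    · exact ⟨110, 140, by omega, h, refute_rep_0_110_140⟩
    rcases lt_or_ge j 180 with h | h
    · exact ⟨140, 180, by omega, h, refute_rep_0_140_180⟩
    rcases lt_or_ge j 230 with h | h
    · exact ⟨180, 230, by omega, h, refute_rep_0_180_230⟩
    exact ⟨230, 344, by omega, hj, refute_rep_0_230_344⟩
  · rcases lt_or_ge j 110 with h | h
    · exact ⟨0, 110, by omega, h, refute_rep_1_0_110⟩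
    rcases lt_or_ge j 180 with h | h
    · exact ⟨110, 180, by omega, h, refute_rep_1_110_180⟩
    exact ⟨180, 344, by omega, hj, refute_rep_1_180_344⟩
  · exact ⟨0, 344, by omega, hj, refute_rep_2⟩
  · exact ⟨0, 344, by omega, hj, refute_rep_3⟩
  · exact ⟨0, 344, by omega, hj, refute_rep_4⟩
  · exact ⟨0, 344, by omega, hj, refute_rep_5⟩
  · exact ⟨0, 344, by omega, hj, refute_rep_6⟩
  · exact ⟨0, 344, by omega, hj, refute_rep_7⟩
  · exact ⟨0, 344, by omega, hj, refute_rep_8⟩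

/-- The order of `reps` matters: each refutation erases the orbits of all earlier representatives.
-/
theorem excluded_of_mem_reps {C : Set (ℕ → Set ℕ)} (hC : StableClass C) :
    ∀ x ∈ reps, Excluded C (0, x) := by
  have h : ∀ i ≤ 9, ∀ x ∈ reps.take i, Excluded C (0, x) := by
    intro i
    induction i with
    | zero => simp
    | succ i ih =>
      intro hi x hx
      have hlen : i < reps.length := hi
      rw [← List.take_concat_get' _ _ hlen, List.mem_append, List.mem_singleton] at hx
      rcases hx with hx | rfl
      · exact ih (by omega) x hx
      · have hnth : reps[i] = nth reps i := (List.getD_eq_getElem _ _ hlen).symm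
        obtain ⟨h1, h2⟩ := reps_spec i hi
        rw [hnth]
        exact Excluded.of_refute hC (ih (by omega)) h1 h2 (exists_refute i hi)
  exact h 9 le_rfl

/-- No system in a stable class has a line through the hexagons `25` and `31`. -/
theorem StableClass.not_both {C : Set (ℕ → Set ℕ)} (hC : StableClass C) {X : ℕ → Set ℕ}
    (hX : X ∈ C) {d : ℕ} (hd : d < 15) {U : Finset ℕ} (hU : mask U ∈ X d) (h25 : 25 ∈ U)
    (h31 : 31 ∈ U) : False := by
  have hm : mask U &&& 2181038080 = 2181038080 := by
    have h : (2181038080 : ℕ) = mask {25, 31} := rfl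
    rw [h, mask_land]
    congr 1
    rw [Finset.inter_eq_right]
    intro i hi
    simp only [Finset.mem_insert, Finset.mem_singleton] at hi
    rcases hi with rfl | rfl <;> assumption
  have hmem := mem_orbits_of_allListed (allListed_lines d hd)
    ((hC.system X hX).mem_lines d hd _ hU) hm
  exact (Excluded.orbits hC (excluded_of_mem_reps hC) _ hmem).2.2 X hX hU

end PlaneCode

/-! ### Counting: line sizes and the six heavy lines -/

namespace PlaneCode
open Configuration ProjectivePlane

section Counting
open scoped Classical
variable {P L : Type*} [Membership P L]

/-- The number of points of `S` on the line `l`. -/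
noncomputable def countOn (S : Finset P) (l : L) : ℕ := (S.filter (· ∈ l)).card

theorem nonempty_points (P L : Type*) [Membership P L] [ProjectivePlane P L] : Nonempty P :=
  ⟨(exists_config (P := P) (L := L)).choose⟩

theorem nonempty_lines (P L : Type*) [Membership P L] [ProjectivePlane P L] : Nonempty L :=
  let ⟨_, _, _, l, _⟩ := exists_config (P := P) (L := L)
  ⟨l⟩

theorem sum_countOn (S : Finset P) (T : Finset L) :
    ∑ l ∈ T, countOn S l = ∑ p ∈ S, (T.filter fun l => p ∈ l).card :=
  Finset.sum_card_bipartiteAbove_eq_sum_card_bipartiteBelow fun (l : L) (p : P) => p ∈ l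

variable [ProjectivePlane P L]

/-- The point of intersection of two distinct lines. -/
noncomputable def meetPt (l m : L) : P :=
  @Classical.epsilon P (nonempty_points P L) fun p => p ∈ l ∧ p ∈ m

/-- The line joining two distinct points. -/
noncomputable def joinLine (p q : P) : L :=
  @Classical.epsilon L (nonempty_lines P L) fun l => p ∈ l ∧ q ∈ l

theorem meetPt_mem {l m : L} (h : l ≠ m) : (meetPt l m : P) ∈ l ∧ (meetPt l m : P) ∈ m :=
  Classical.epsilon_spec (p := fun p : P => p ∈ l ∧ p ∈ m)
    ⟨HasPoints.mkPoint h, HasPoints.mkPoint_ax h⟩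

theorem joinLine_mem {p q : P} (h : p ≠ q) : p ∈ (joinLine p q : L) ∧ q ∈ (joinLine p q : L) :=
  Classical.epsilon_spec (p := fun l : L => p ∈ l ∧ q ∈ l)
    ⟨HasLines.mkLine h, HasLines.mkLine_ax h⟩

/-- The chosen point depends only on the predicate, so symmetry holds even for `l = m`. -/
theorem meetPt_comm (l m : L) : (meetPt l m : P) = meetPt m l := by
  unfold meetPt
  simp only [and_comm]

theorem eq_of_mem {p q : P} {l m : L} (hpq : p ≠ q) (hp : p ∈ l) (hq : q ∈ l) (hp' : p ∈ m)
    (hq' : q ∈ m) : l = m :=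
  (Nondegenerate.eq_or_eq hp hq hp' hq').resolve_left hpq

theorem point_eq_of_mem {p q : P} {l m : L} (hlm : l ≠ m) (hp : p ∈ l) (hq : q ∈ l) (hp' : p ∈ m)
    (hq' : q ∈ m) : p = q :=
  (Nondegenerate.eq_or_eq hp hq hp' hq').resolve_right hlm

/-- The support of a word of weight `15`: a set of fifteen points in a plane of order ten that
meets all lines in an odd number of points. -/
structure OddSet (L : Type*) [Membership P L] [ProjectivePlane P L] (S : Finset P) : Prop where
  order_eq : order P L = 10
  card_eq : S.card = 15
  odd : ∀ l : L, Odd (countOn S l)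

theorem OddSet.pos {S : Finset P} (hS : OddSet L S) (l : L) : 1 ≤ countOn S l :=
  (hS.odd l).pos

variable [Fintype L]

theorem card_lines_joining {p q : P} (h : p ≠ q) :
    (Finset.univ.filter fun l : L => q ∈ l ∧ p ∈ l).card = 1 := by
  rw [Finset.card_eq_one]
  obtain ⟨hp, hq⟩ := joinLine_mem (L := L) h
  refine ⟨joinLine p q, Finset.ext fun l => ?_⟩
  simp only [Finset.mem_filter, Finset.mem_univ, true_and, Finset.mem_singleton]
  exact ⟨fun hl => eq_of_mem h hl.2 hl.1 hp hq, by rintro rfl; exact ⟨hq, hp⟩⟩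

variable [Fintype P]

theorem card_points_on (l : L) :
    (Finset.univ.filter fun p : P => p ∈ l).card = order P L + 1 := by
  rw [← pointCount_eq P l, pointCount, Nat.card_eq_fintype_card, Fintype.card_subtype]

theorem card_lines_through (p : P) :
    (Finset.univ.filter fun l : L => p ∈ l).card = order P L + 1 := by
  rw [← lineCount_eq L p, lineCount, Nat.card_eq_fintype_card, Fintype.card_subtype]

/-- A point of `S` other than `q` lies on one line through `q`; `q` itself lies on all `order P L +
1`. -/
theorem sum_countOn_through (S : Finset P) (q : P) :
    ∑ l ∈ Finset.univ.filter (fun l : L => q ∈ l), countOn S l =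
      S.card + if q ∈ S then order P L else 0 := by
  have h : ∀ p ∈ S, ((Finset.univ.filter (fun l : L => q ∈ l)).filter fun l => p ∈ l).card =
      1 + if p = q then order P L else 0 := by
    intro p _
    rw [Finset.filter_filter]
    split_ifs with hpq
    · subst hpq
      simp only [and_self]
      rw [card_lines_through, add_comm]
    · exact card_lines_joining hpq
  rw [sum_countOn, Finset.sum_congr rfl h, Finset.sum_add_distrib, Finset.sum_ite_eq']
  simp

namespace OddSet
variable {S : Finset P} (hS : OddSet L S)
include hS

theorem sum_off {q : P} (hq : q ∉ S) :
    ∑ l ∈ Finset.univ.filter (fun l : L => q ∈ l), countOn S l = 15 := by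
  rw [sum_countOn_through, hS.card_eq, if_neg hq]

theorem sum_on {q : P} (hq : q ∈ S) :
    ∑ l ∈ Finset.univ.filter (fun l : L => q ∈ l), countOn S l = 25 := by
  rw [sum_countOn_through, hS.card_eq, if_pos hq, hS.order_eq]

/-- The eleven lines through `q` share 15 points and each has at least one, so the excess over one
per line is at most 4. -/
theorem off_bound {q : P} (hq : q ∉ S) (T : Finset L) (hT : ∀ l ∈ T, q ∈ l) :
    ∑ l ∈ T, countOn S l ≤ T.card + 4 := by
  have hsub : T ⊆ Finset.univ.filter (fun l : L => q ∈ l) := fun l hl => by simp [hT l hl]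
  have h1 := hS.sum_off (L := L) hq
  rw [← Finset.sum_sdiff hsub] at h1
  have h2 : _ ≤ ∑ l ∈ Finset.univ.filter (fun l : L => q ∈ l) \ T, countOn S l :=
    Finset.card_nsmul_le_sum _ _ 1 fun l _ => hS.pos l
  rw [Finset.card_sdiff_of_subset hsub, card_lines_through, hS.order_eq, smul_eq_mul] at h2
  omega

theorem off_two {q : P} (hq : q ∉ S) {l m : L} (hlm : l ≠ m) (hl : q ∈ l) (hm : q ∈ m) :
    countOn S l + countOn S m ≤ 6 := by
  have := hS.off_bound hq {l, m} (by simp [hl, hm])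
  rwa [Finset.sum_pair hlm, Finset.card_pair hlm] at this

theorem off_three {q : P} (hq : q ∉ S) {l m n : L} (hlm : l ≠ m) (hln : l ≠ n) (hmn : m ≠ n)
    (hl : q ∈ l) (hm : q ∈ m) (hn : q ∈ n) : countOn S l + countOn S m + countOn S n ≤ 7 := by
  have := hS.off_bound hq {l, m, n} (by simp [hl, hm, hn])
  rw [Finset.sum_insert (by simp [hlm, hln]), Finset.sum_pair hmn,
    Finset.card_insert_of_notMem (by simp [hlm, hln]), Finset.card_pair hmn] at this
  omega

/-- A line with a point off `S` is bounded by the excess there. If a line lay inside `S`, every line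
through a point of `S` outside it would have at least two, hence three, points of `S`, and 33
exceeds 25. -/
theorem le_five (l : L) : countOn S l ≤ 5 := by
  by_cases h : ∃ q ∈ l, q ∉ S
  · obtain ⟨q, hql, hq⟩ := h
    have := hS.off_bound hq {l} (by simpa using hql)
    rw [Finset.sum_singleton, Finset.card_singleton] at this
    omega
  · push Not at h
    have hcard : (Finset.univ.filter fun p : P => p ∈ l).card < S.card := by
      rw [card_points_on, hS.order_eq, hS.card_eq]; norm_num
    obtain ⟨p, hpS, hpl⟩ := Finset.exists_mem_notMem_of_card_lt_card hcard
    replace hpl : p ∉ l := by simpa using hpl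
    have h3 : ∀ m ∈ Finset.univ.filter (fun m : L => p ∈ m), 3 ≤ countOn S m := by
      intro m hm
      replace hm : p ∈ m := by simpa using hm
      have hlm : l ≠ m := by rintro rfl; exact hpl hm
      obtain ⟨h1, h2⟩ := meetPt_mem (P := P) hlm
      have hne : p ≠ meetPt l m := by intro h0; rw [← h0] at h1; exact hpl h1
      have h2 : 2 ≤ countOn S m := by
        rw [← Finset.card_pair hne]
        refine Finset.card_le_card fun x hx => ?_
        rcases Finset.mem_insert.1 hx with rfl | hx
        · simp [hpS, hm]
        · rw [Finset.mem_singleton.1 hx]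
          simp [h _ h1, h2]
      obtain ⟨k, hk⟩ := hS.odd m
      omega
    have h1 := Finset.card_nsmul_le_sum _ _ 3 h3
    rw [hS.sum_on hpS, card_lines_through, hS.order_eq, smul_eq_mul] at h1
    omega

theorem cases_countOn (l : L) : countOn S l = 1 ∨ countOn S l = 3 ∨ countOn S l = 5 := by
  have h1 := hS.le_five l
  obtain ⟨k, hk⟩ := hS.odd l
  omega

/-- For `n` in {1, 3, 5}, `(n - 1)(n - 3)` is 8 if `n = 5` and 0 otherwise. Its sum over the 111
lines is 375 - 4 · 165 + 333 = 48. -/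
theorem card_heavy : (Finset.univ.filter fun l : L => countOn S l = 5).card = 6 := by
  have hlines : Fintype.card L = 111 := by rw [card_lines P L, hS.order_eq]; norm_num
  have h1 : ∑ l : L, countOn S l = 165 := by
    rw [sum_countOn, Finset.sum_congr rfl fun p _ => card_lines_through (L := L) p,
      Finset.sum_const,
      hS.card_eq, hS.order_eq]
    rfl
  have h2 : ∑ l : L, countOn S l * countOn S l = 375 := by
    have : ∀ l : L, countOn S l * countOn S l = ∑ p ∈ S, if p ∈ l then countOn S l else 0 := by
      intro l
      rw [← Finset.sum_filter, Finset.sum_const, smul_eq_mul]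
      rfl
    rw [Finset.sum_congr rfl fun l _ => this l, Finset.sum_comm]
    rw [Finset.sum_congr rfl fun p hp => by rw [← Finset.sum_filter, hS.sum_on hp],
      Finset.sum_const, hS.card_eq]
    rfl
  have h3 : ∑ l : L, (countOn S l * countOn S l + 3) =
      ∑ l : L, (4 * countOn S l + 8 * if countOn S l = 5 then 1 else 0) := by
    refine Finset.sum_congr rfl fun l _ => ?_
    rcases hS.cases_countOn l with h | h | h <;> rw [h] <;> rfl
  rw [Finset.sum_add_distrib, Finset.sum_add_distrib, ← Finset.mul_sum, ← Finset.mul_sum, h1, h2,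
    Finset.sum_const, Finset.card_univ, hlines, ← Finset.card_filter, smul_eq_mul] at h3
  omega

theorem meet_heavy_mem {l m : L} (h : l ≠ m) (hl : 2 ≤ countOn S l) (hm : countOn S m = 5) :
    (meetPt l m : P) ∈ S := by
  by_contra hq
  obtain ⟨h1, h2⟩ := meetPt_mem (P := P) h
  have := hS.off_two hq h h1 h2
  omega

/-- Let `c p` count the heavy lines through `p`. Any two heavy lines meet in `S`, so `c` has sum 30
and its square has sum 6 · 5 + 30 = 60. Hence the sum of `(c p - 2) ^ 2` over the 15 points is 60 -
120 + 60 = 0. -/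
theorem card_heavy_through {p : P} (hp : p ∈ S) :
    (Finset.univ.filter fun l : L => countOn S l = 5 ∧ p ∈ l).card = 2 := by
  set H := Finset.univ.filter fun l : L => countOn S l = 5 with hH
  have hmem : ∀ l ∈ H, countOn S l = 5 := fun l hl => (Finset.mem_filter.1 hl).2
  set c : P → ℕ := fun p => (H.filter fun l => p ∈ l).card with hc
  have h1 : ∑ p ∈ S, c p = 30 := by
    rw [hc, ← sum_countOn, Finset.sum_congr rfl fun l hl => hmem l hl, Finset.sum_const,
      hS.card_heavy]
    rfl
  have h2 : ∑ p ∈ S, c p * c p = 60 := by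
    have : ∀ p, c p * c p = ∑ l ∈ H, ∑ m ∈ H, if p ∈ l ∧ p ∈ m then 1 else 0 := by
      intro p
      simp only [hc, Finset.card_filter, Finset.sum_mul_sum]
      refine Finset.sum_congr rfl fun l _ => Finset.sum_congr rfl fun m _ => ?_
      by_cases h1 : p ∈ l <;> by_cases h2 : p ∈ m <;> simp [h1, h2]
    have h3 : ∀ l ∈ H, ∀ m ∈ H, (∑ p ∈ S, if p ∈ l ∧ p ∈ m then 1 else 0) =
        1 + if l = m then 4 else 0 := by
      intro l hl m hm
      rw [← Finset.card_filter]
      split_ifs with h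
      · subst h
        simp only [and_self]
        exact hmem l hl
      · obtain ⟨h1, h2⟩ := meetPt_mem (P := P) h
        rw [Finset.card_eq_one]
        refine ⟨meetPt l m, Finset.ext fun p => ?_⟩
        rw [Finset.mem_filter, Finset.mem_singleton]
        constructor
        · exact fun hp => point_eq_of_mem h hp.2.1 h1 hp.2.2 h2
        · rintro rfl
          exact ⟨hS.meet_heavy_mem h (by rw [hmem l hl]; norm_num) (hmem m hm), h1, h2⟩
    rw [Finset.sum_congr rfl fun p _ => this p, Finset.sum_comm]
    have h4 : ∀ l ∈ H, (∑ p ∈ S, ∑ m ∈ H, if p ∈ l ∧ p ∈ m then 1 else 0) = 10 := by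
      intro l hl
      rw [Finset.sum_comm, Finset.sum_congr rfl fun m hm => h3 l hl m hm, Finset.sum_add_distrib,
        Finset.sum_ite_eq, if_pos hl, Finset.sum_const, hS.card_heavy]
      rfl
    rw [Finset.sum_congr rfl h4, Finset.sum_const, hS.card_heavy]
    rfl
  have h3 : ∑ p ∈ S, ((c p : ℤ) - 2) ^ 2 = 0 := by
    have h : ∀ p ∈ S, ((c p : ℤ) - 2) ^ 2 = ((c p * c p : ℕ) : ℤ) - 4 * (c p : ℤ) + 4 := by
      intro p _; push_cast; ring
    rw [Finset.sum_congr rfl h, Finset.sum_add_distrib, Finset.sum_sub_distrib, ← Nat.cast_sum, h2,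
      ← Finset.mul_sum, ← Nat.cast_sum, h1, Finset.sum_const, hS.card_eq]
    norm_num
  have h4 := (Finset.sum_eq_zero_iff_of_nonneg fun p _ => sq_nonneg _).1 h3 p hp
  have h5 : c p = 2 := by
    have := pow_eq_zero_iff (two_ne_zero) |>.1 h4
    omega
  rw [← h5, hc, hH]
  simp only [Finset.filter_filter]

end OddSet
end Counting
end PlaneCode

/-! ### Duads label the points of `S`, synthemes the lines with three points -/

namespace PlaneCode
open Configuration ProjectivePlane

/-- The duad at position `d`. -/
def Side (d i : ℕ) : Prop := (duad d).1 = i ∨ (duad d).2 = i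

instance (d i : ℕ) : Decidable (Side d i) := inferInstanceAs (Decidable (_ ∨ _))

/-- The duads at two positions have no element in common. -/
def DisjointDuads (d e : ℕ) : Prop := ∀ i < 6, Side d i → ¬ Side e i

instance (d e : ℕ) : Decidable (DisjointDuads d e) :=
  inferInstanceAs (Decidable (∀ i < 6, Side d i → ¬ Side e i))

theorem duad_lt : ∀ d < 15, (duad d).1 < (duad d).2 ∧ (duad d).2 < 6 := by
  decide +kernel

theorem duad_ext : ∀ d < 15, ∀ e < 15, Side d (duad e).1 → Side d (duad e).2 → d = e := by
  decide +kernel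

/-- The first two duads of the syntheme at position `s`. -/
def synthemePair (s : ℕ) : ℕ × ℕ :=
  let l := (List.range 15).filter fun d => InSyntheme d s
  (l.getD 0 0, l.getD 1 0)

theorem synthemePair_spec : ∀ s < 15, (synthemePair s).1 < 15 ∧ (synthemePair s).2 < 15 ∧
    InSyntheme (synthemePair s).1 s ∧ InSyntheme (synthemePair s).2 s := by
  decide +kernel

theorem synthemePair_disjoint : ∀ s < 15, DisjointDuads (synthemePair s).1 (synthemePair s).2 ∧
    ∀ c < 15, InSyntheme c s → c = (synthemePair s).1 ∨ c = (synthemePair s).2 ∨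
      DisjointDuads (synthemePair s).1 c ∧ DisjointDuads (synthemePair s).2 c := by
  decide +kernel

theorem disjointDuads_cover : ∀ d < 15, ∀ e < 15, DisjointDuads d e →
    ∃ s < 15, InSyntheme d s ∧ InSyntheme e s := by
  decide +kernel

theorem card_inSyntheme : ∀ s < 15,
    ((Finset.range 15).filter fun d => InSyntheme d s).card = 3 := by
  decide +kernel

theorem syntheme_ext : ∀ s < 15, ∀ t < 15, (∀ d < 15, InSyntheme d s → InSyntheme d t) → s = t := by
  decide +kernel

theorem exists_not_inSyntheme : ∀ d < 15, ∃ s < 15, ¬ InSyntheme d s := by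
  decide +kernel

theorem hexagon_disjoint : ∀ b < 60, ∀ d < 15,
    InSyntheme d (hexagon b).1 → ¬ InSyntheme d (hexagon b).2 := by
  decide +kernel

theorem exists_hexagon : ∀ s < 15, ∀ t < 15, (∀ d < 15, InSyntheme d s → ¬ InSyntheme d t) →
    ∃ b < 60, InHexagon s b ∧ InHexagon t b := by
  decide +kernel

theorem hexagon_ext : ∀ b < 60, ∀ c < 60, InHexagon (hexagon b).1 c → InHexagon (hexagon b).2 c →
    b = c := by
  decide +kernel

theorem hexagons_25_31 : ∀ s < 15, InHexagon s 25 → ¬ InHexagon s 31 := by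
  decide +kernel

/-- The transposition of `k` and `k + 1`. -/
def adj (k i : ℕ) : ℕ := if i = k then k + 1 else if i = k + 1 then k else i

theorem adj_spec : ∀ k < 5, ∀ i < 6, adj k i < 6 ∧ adj k (adj k i) = i := by
  decide +kernel

theorem duad_duadImage : ∀ k < 5, ∀ d < 15,
    duad (duadImage k d) = (adj k (duad d).1, adj k (duad d).2) ∨
    duad (duadImage k d) = (adj k (duad d).2, adj k (duad d).1) := by
  decide +kernel

theorem inSyntheme_image : ∀ k < 5, ∀ s < 15, synthemeImage k s < 15 ∧
    ∀ d < 15, InSyntheme d s → InSyntheme (duadImage k d) (synthemeImage k s) := by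
  decide +kernel

theorem hexagon_hexImage : ∀ k < 5, ∀ b < 60,
    hexagon (hexImage k b) =
      (synthemeImage k (hexagon b).1, synthemeImage k (hexagon b).2) ∨
    hexagon (hexImage k b) =
      (synthemeImage k (hexagon b).2, synthemeImage k (hexagon b).1) := by
  decide +kernel

section Labelling
open scoped Classical
variable {P L : Type*} [Membership P L]

/-- An enumeration of the six lines meeting `S` in five points. -/
structure Labelling (S : Finset P) (h : ℕ → L) : Prop where
  heavy : ∀ i < 6, countOn S (h i) = 5
  inj : ∀ i < 6, ∀ j < 6, h i = h j → i = j
  surj : ∀ l, countOn S l = 5 → ∃ i < 6, h i = l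

theorem Labelling.comp_adj {S : Finset P} {h : ℕ → L} (lab : Labelling S h) {k : ℕ} (hk : k < 5) :
    Labelling S (h ∘ adj k) where
  heavy i hi := lab.heavy _ (adj_spec k hk i hi).1
  inj i hi j hj hij := by
    have := lab.inj _ (adj_spec k hk i hi).1 _ (adj_spec k hk j hj).1 hij
    rw [← (adj_spec k hk i hi).2, this, (adj_spec k hk j hj).2]
  surj l hl := by
    obtain ⟨i, hi, rfl⟩ := lab.surj l hl
    exact ⟨adj k i, (adj_spec k hk i hi).1, congrArg h (adj_spec k hk i hi).2⟩

theorem Labelling.ne {S : Finset P} {h : ℕ → L} (lab : Labelling S h) {d : ℕ} (hd : d < 15) :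
    h (duad d).1 ≠ h (duad d).2 := by
  obtain ⟨h1, h2⟩ := duad_lt d hd
  exact fun h0 => h1.ne (lab.inj _ (h1.trans h2) _ h2 h0)

variable [ProjectivePlane P L]

/-- The point labelled by a duad. -/
noncomputable def duadPt (h : ℕ → L) (d : ℕ) : P := meetPt (h (duad d).1) (h (duad d).2)

variable (P) in
/-- The line labelled by a syntheme. -/
noncomputable def synthemeLine (h : ℕ → L) (s : ℕ) : L :=
  joinLine (duadPt h (synthemePair s).1 : P) (duadPt h (synthemePair s).2)

/-- The point labelled by a hexagon. -/
noncomputable def hexagonPt (h : ℕ → L) (b : ℕ) : P :=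
  meetPt (synthemeLine P h (hexagon b).1) (synthemeLine P h (hexagon b).2)

variable (P) in
/-- The hexagons whose points lie on a line. -/
noncomputable def hexagonsOn (h : ℕ → L) (l : L) : Finset ℕ :=
  (Finset.range 60).filter fun b => (hexagonPt h b : P) ∈ l

theorem mem_hexagonsOn {h : ℕ → L} {l : L} {b : ℕ} :
    b ∈ hexagonsOn P h l ↔ b < 60 ∧ (hexagonPt h b : P) ∈ l := by
  simp [hexagonsOn]

theorem duadPt_comp_adj {k : ℕ} (hk : k < 5) (h : ℕ → L) {d : ℕ} (hd : d < 15) :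
    (duadPt (h ∘ adj k) d : P) = duadPt h (duadImage k d) := by
  unfold duadPt
  rcases duad_duadImage k hk d hd with h0 | h0 <;> rw [h0]
  · rfl
  · rw [meetPt_comm]; rfl

theorem Labelling.duadPt_mem {S : Finset P} {h : ℕ → L} (lab : Labelling S h) {d i : ℕ}
    (hd : d < 15) (hi : Side d i) :
    (duadPt h d : P) ∈ h i := by
  obtain ⟨h1, h2⟩ := meetPt_mem (P := P) (lab.ne hd)
  rcases hi with rfl | rfl
  exacts [h1, h2]

variable [Fintype P] [Fintype L] {S : Finset P}

theorem OddSet.exists_labelling (hS : OddSet L S) : ∃ h : ℕ → L, Labelling S h := by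
  set H := Finset.univ.filter fun l : L => countOn S l = 5 with hH
  let e := H.equivFinOfCardEq hS.card_heavy
  have hmem : ∀ l, l ∈ H ↔ countOn S l = 5 := by simp [hH]
  refine ⟨fun i => (e.symm (Fin.ofNat 6 i)).1, fun i _ => (hmem _).1 (e.symm _).2,
    fun i hi j hj hij => ?_, fun l hl => ?_⟩
  · have := congrArg Fin.val (e.symm.injective (Subtype.ext hij))
    simpa [Nat.mod_eq_of_lt hi, Nat.mod_eq_of_lt hj] using this
  · refine ⟨(e ⟨l, (hmem l).2 hl⟩).1, (e ⟨l, (hmem l).2 hl⟩).2, ?_⟩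
    simp

namespace Labelling
variable {h : ℕ → L} (lab : Labelling S h) (hS : OddSet L S)

section
include lab

include hS

theorem duadPt_mem_support {d : ℕ} (hd : d < 15) : (duadPt h d : P) ∈ S := by
  obtain ⟨h1, h2⟩ := duad_lt d hd
  exact hS.meet_heavy_mem (lab.ne hd) (by rw [lab.heavy _ (h1.trans h2)]; norm_num)
    (lab.heavy _ h2)

/-- Otherwise three heavy lines would pass through one point of `S`. -/
theorem side_of_mem {d i : ℕ} (hd : d < 15) (hi : i < 6) (hm : (duadPt h d : P) ∈ h i) :
    Side d i := by
  obtain ⟨h1, h2⟩ := duad_lt d hd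
  by_contra hcon
  rw [Side, not_or] at hcon
  have hcard := hS.card_heavy_through (lab.duadPt_mem_support hS hd)
  have hsub : ({h (duad d).1, h (duad d).2, h i} : Finset L) ⊆
      Finset.univ.filter fun l : L => countOn S l = 5 ∧ (duadPt h d : P) ∈ l := by
    intro l hl
    simp only [Finset.mem_insert, Finset.mem_singleton] at hl
    rw [Finset.mem_filter]
    rcases hl with rfl | rfl | rfl
    · exact ⟨Finset.mem_univ _, lab.heavy _ (h1.trans h2), lab.duadPt_mem hd (Or.inl rfl)⟩
    · exact ⟨Finset.mem_univ _, lab.heavy _ h2, lab.duadPt_mem hd (Or.inr rfl)⟩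
    · exact ⟨Finset.mem_univ _, lab.heavy _ hi, hm⟩
  have := Finset.card_le_card hsub
  rw [hcard, Finset.card_eq_three.2 ⟨_, _, _, lab.ne hd,
    fun h0 => hcon.1 (lab.inj _ (h1.trans h2) _ hi h0),
    fun h0 => hcon.2 (lab.inj _ h2 _ hi h0), rfl⟩] at this
  omega

theorem duadPt_inj {d e : ℕ} (hd : d < 15) (he : e < 15)
    (hde : (duadPt h d : P) = duadPt h e) : d = e := by
  obtain ⟨h1, h2⟩ := duad_lt e he
  refine duad_ext d hd e he (lab.side_of_mem hS hd (h1.trans h2) ?_) (lab.side_of_mem hS hd h2 ?_)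
  · rw [hde]; exact lab.duadPt_mem he (Or.inl rfl)
  · rw [hde]; exact lab.duadPt_mem he (Or.inr rfl)

theorem image_duadPt : (Finset.range 15).image (duadPt h) = S := by
  refine Finset.eq_of_subset_of_card_le (fun p hp => ?_) ?_
  · obtain ⟨d, hd, rfl⟩ := Finset.mem_image.1 hp
    exact lab.duadPt_mem_support hS (Finset.mem_range.1 hd)
  · rw [Finset.card_image_of_injOn fun d hd e he hde => lab.duadPt_inj hS
      (Finset.mem_range.1 hd) (Finset.mem_range.1 he) hde, hS.card_eq]
    rfl

theorem exists_duadPt {p : P} (hp : p ∈ S) : ∃ d < 15, duadPt h d = p := by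
  rw [← lab.image_duadPt hS, Finset.mem_image] at hp
  obtain ⟨d, hd, rfl⟩ := hp
  exact ⟨d, Finset.mem_range.1 hd, rfl⟩

theorem countOn_eq (l : L) :
    countOn S l = ((Finset.range 15).filter fun d => (duadPt h d : P) ∈ l).card := by
  unfold countOn
  conv_lhs => rw [← lab.image_duadPt hS, Finset.filter_image]
  refine Finset.card_image_of_injOn fun d hd e he hde => ?_
  exact lab.duadPt_inj hS (Finset.mem_range.1 (Finset.mem_filter.1 hd).1)
    (Finset.mem_range.1 (Finset.mem_filter.1 he).1) hde

theorem card_le_countOn {l : L} {D : Finset ℕ} (hD : ∀ d ∈ D, d < 15 ∧ (duadPt h d : P) ∈ l) :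
    D.card ≤ countOn S l := by
  rw [lab.countOn_eq hS]
  refine Finset.card_le_card fun d hd => ?_
  rw [Finset.mem_filter, Finset.mem_range]
  exact hD d hd

theorem disjoint_of_countOn {l : L} (hl : countOn S l = 3) {d e : ℕ} (hd : d < 15) (he : e < 15)
    (hde : d ≠ e) (hdl : (duadPt h d : P) ∈ l) (hel : (duadPt h e : P) ∈ l) :
    DisjointDuads d e := by
  intro i hi h1 h2
  have := eq_of_mem (fun h0 => hde (lab.duadPt_inj hS hd he h0)) hdl hel (lab.duadPt_mem hd h1)
    (lab.duadPt_mem he h2)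
  rw [this, lab.heavy i hi] at hl
  omega

theorem countOn_of_disjoint {l : L} {d e : ℕ} (hd : d < 15) (he : e < 15)
    (hde : DisjointDuads d e) (hdl : (duadPt h d : P) ∈ l) (hel : (duadPt h e : P) ∈ l) :
    countOn S l = 3 := by
  have hlt := duad_lt d hd
  have hne : d ≠ e := by
    rintro rfl
    exact hde _ (hlt.1.trans hlt.2) (Or.inl rfl) (Or.inl rfl)
  have h2 := lab.card_le_countOn hS (l := l) (D := {d, e}) (by simp [hd, he, hdl, hel])
  rw [Finset.card_pair hne] at h2
  rcases hS.cases_countOn l with h0 | h0 | h0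
  · omega
  · exact h0
  · obtain ⟨i, hi, rfl⟩ := lab.surj l h0
    exact absurd (lab.side_of_mem hS he hi hel) (hde i hi (lab.side_of_mem hS hd hi hdl))

/-- The line has three points and meets each of the two heavy lines of `f` in a point of `S`. Those
points differ from `d` and `e`, so they coincide, and the only duad on both heavy lines is `f`. -/
theorem third_mem {l : L} {d e f : ℕ} (hd : d < 15) (he : e < 15) (hf : f < 15)
    (hde : DisjointDuads d e) (hdf : DisjointDuads d f) (hef : DisjointDuads e f)
    (hdl : (duadPt h d : P) ∈ l) (hel : (duadPt h e : P) ∈ l) : (duadPt h f : P) ∈ l := by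
  have hl := lab.countOn_of_disjoint hS hd he hde hdl hel
  obtain ⟨hf1, hf2⟩ := duad_lt f hf
  have key : ∀ k < 6, Side f k → ∃ a < 15, (duadPt h a : P) ∈ l ∧ Side a k := by
    intro k hk _
    have hne : l ≠ h k := by
      rintro rfl
      rw [lab.heavy k hk] at hl
      omega
    obtain ⟨a, ha, hap⟩ := lab.exists_duadPt hS
      (hS.meet_heavy_mem hne (by omega) (lab.heavy k hk))
    obtain ⟨h1, h2⟩ := meetPt_mem (P := P) hne
    rw [← hap] at h1 h2
    exact ⟨a, ha, h1, lab.side_of_mem hS ha hk h2⟩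
  obtain ⟨a, ha, hal, hak⟩ := key _ (hf1.trans hf2) (Or.inl rfl)
  obtain ⟨b, hb, hbl, hbk⟩ := key _ hf2 (Or.inr rfl)
  have hlt := duad_lt d hd
  have hde' : d ≠ e := by
    rintro rfl
    exact hde _ (hlt.1.trans hlt.2) (Or.inl rfl) (Or.inl rfl)
  have had : a ≠ d := by rintro rfl; exact hdf _ (hf1.trans hf2) hak (Or.inl rfl)
  have hae : a ≠ e := by rintro rfl; exact hef _ (hf1.trans hf2) hak (Or.inl rfl)
  have hbd : b ≠ d := by rintro rfl; exact hdf _ hf2 hbk (Or.inr rfl)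
  have hbe : b ≠ e := by rintro rfl; exact hef _ hf2 hbk (Or.inr rfl)
  have hab : a = b := by
    by_contra hab
    have := lab.card_le_countOn hS (l := l) (D := {a, b, d, e}) (by
      simp [ha, hb, hd, he, hal, hbl, hdl, hel])
    rw [Finset.card_insert_of_notMem (by simp [hab, had, hae]),
      Finset.card_insert_of_notMem (by simp [hbd, hbe]), Finset.card_pair hde', hl] at this
    omega
  subst hab
  rwa [← duad_ext a ha f hf hak hbk]

theorem synthemeLine_mem {c s : ℕ} (hc : c < 15) (hs : s < 15) (hcs : InSyntheme c s) :
    (duadPt h c : P) ∈ synthemeLine P h s := by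
  obtain ⟨ha, hb, -, -⟩ := synthemePair_spec s hs
  obtain ⟨hab, hall⟩ := synthemePair_disjoint s hs
  have hne : (duadPt h (synthemePair s).1 : P) ≠ duadPt h (synthemePair s).2 := by
    intro h0
    have hlt := duad_lt _ ha
    have := lab.duadPt_inj hS ha hb h0
    rw [← this] at hab
    exact hab _ (hlt.1.trans hlt.2) (Or.inl rfl) (Or.inl rfl)
  obtain ⟨h1, h2⟩ := joinLine_mem (L := L) hne
  rcases hall c hc hcs with rfl | rfl | ⟨h3, h4⟩
  · exact h1
  · exact h2
  · exact lab.third_mem hS ha hb hc hab h3 h4 h1 h2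

theorem countOn_synthemeLine {s : ℕ} (hs : s < 15) : countOn S (synthemeLine P h s) = 3 := by
  obtain ⟨ha, hb, ha', hb'⟩ := synthemePair_spec s hs
  exact lab.countOn_of_disjoint hS ha hb (synthemePair_disjoint s hs).1
    (lab.synthemeLine_mem hS ha hs ha') (lab.synthemeLine_mem hS hb hs hb')

theorem inSyntheme_of_mem {c s : ℕ} (hc : c < 15) (hs : s < 15)
    (hcs : (duadPt h c : P) ∈ synthemeLine P h s) : InSyntheme c s := by
  have heq : ((Finset.range 15).filter fun d => InSyntheme d s) =
      (Finset.range 15).filter fun d => (duadPt h d : P) ∈ synthemeLine P h s := by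
    refine Finset.eq_of_subset_of_card_le (fun d hd => ?_) ?_
    · rw [Finset.mem_filter, Finset.mem_range] at hd ⊢
      exact ⟨hd.1, lab.synthemeLine_mem hS hd.1 hs hd.2⟩
    · have h1 := card_inSyntheme s hs
      rw [← lab.countOn_eq hS, lab.countOn_synthemeLine hS hs, ← h1]
  have : c ∈ (Finset.range 15).filter fun d => InSyntheme d s := by
    rw [heq, Finset.mem_filter, Finset.mem_range]
    exact ⟨hc, hcs⟩
  exact (Finset.mem_filter.1 this).2

theorem synthemeLine_inj {s t : ℕ} (hs : s < 15) (ht : t < 15)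
    (hst : synthemeLine P h s = synthemeLine P h t) : s = t :=
  syntheme_ext s hs t ht fun _ hd hds => lab.inSyntheme_of_mem hS hd ht
    (hst ▸ lab.synthemeLine_mem hS hd hs hds)

theorem synthemeLine_eq {l : L} {d e s : ℕ} (hd : d < 15) (he : e < 15) (hs : s < 15)
    (hde : d ≠ e) (hds : InSyntheme d s) (hes : InSyntheme e s) (hdl : (duadPt h d : P) ∈ l)
    (hel : (duadPt h e : P) ∈ l) : synthemeLine P h s = l :=
  eq_of_mem (fun h0 => hde (lab.duadPt_inj hS hd he h0)) (lab.synthemeLine_mem hS hd hs hds)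
    (lab.synthemeLine_mem hS he hs hes) hdl hel

theorem exists_synthemeLine {l : L} (hl : countOn S l = 3) : ∃ s < 15, synthemeLine P h s = l := by
  have h1 : 1 < ((Finset.range 15).filter fun d => (duadPt h d : P) ∈ l).card := by
    rw [← lab.countOn_eq hS, hl]; norm_num
  obtain ⟨d, hd, e, he, hde⟩ := Finset.one_lt_card.1 h1
  rw [Finset.mem_filter, Finset.mem_range] at hd he
  obtain ⟨s, hs, hds, hes⟩ := disjointDuads_cover d hd.1 e he.1
    (lab.disjoint_of_countOn hS hl hd.1 he.1 hde hd.2 he.2)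
  exact ⟨s, hs, lab.synthemeLine_eq hS hd.1 he.1 hs hde hds hes hd.2 he.2⟩

end
end Labelling
end Labelling
end PlaneCode

/-! ### Hexagon points, simple lines, and the contradiction -/

namespace PlaneCode
open Configuration ProjectivePlane

section Simple
open scoped Classical
variable {P L : Type*} [Membership P L] [ProjectivePlane P L] [Fintype P] [Fintype L]
  {S : Finset P}

namespace Labelling
variable {h : ℕ → L} (lab : Labelling S h) (hS : OddSet L S)

section
include lab hS

theorem hexagon_ne {b : ℕ} (hb : b < 60) :
    synthemeLine P h (hexagon b).1 ≠ synthemeLine P h (hexagon b).2 := by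
  obtain ⟨h1, h2⟩ := hexagon_lt b hb
  exact fun h0 => h1.ne (lab.synthemeLine_inj hS (h1.trans h2) h2 h0)

theorem hexagonPt_mem {b s : ℕ} (hb : b < 60) (hs : InHexagon s b) :
    (hexagonPt h b : P) ∈ synthemeLine P h s := by
  obtain ⟨h1, h2⟩ := meetPt_mem (P := P) (lab.hexagon_ne hS hb)
  rcases hs with rfl | rfl
  exacts [h1, h2]

theorem hexagonPt_notMem {b : ℕ} (hb : b < 60) : (hexagonPt h b : P) ∉ S := by
  intro hbS
  obtain ⟨h1, h2⟩ := hexagon_lt b hb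
  obtain ⟨d, hd, hdb⟩ := lab.exists_duadPt hS hbS
  refine hexagon_disjoint b hb d hd (lab.inSyntheme_of_mem hS hd (h1.trans h2) ?_)
    (lab.inSyntheme_of_mem hS hd h2 ?_)
  · rw [hdb]; exact lab.hexagonPt_mem hS hb (Or.inl rfl)
  · rw [hdb]; exact lab.hexagonPt_mem hS hb (Or.inr rfl)

/-- The two syntheme lines through a hexagon point use up the whole excess of four there. -/
theorem inHexagon_of_mem {l : L} {b : ℕ} (hb : b < 60) (hl : 3 ≤ countOn S l)
    (hbl : (hexagonPt h b : P) ∈ l) : ∃ s < 15, InHexagon s b ∧ synthemeLine P h s = l := by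
  obtain ⟨h1, h2⟩ := hexagon_lt b hb
  by_contra! hcon
  have := hS.off_three (lab.hexagonPt_notMem hS hb) (lab.hexagon_ne hS hb)
    (hcon _ (h1.trans h2) (Or.inl rfl)) (hcon _ h2 (Or.inr rfl))
    (lab.hexagonPt_mem hS hb (Or.inl rfl)) (lab.hexagonPt_mem hS hb (Or.inr rfl)) hbl
  rw [lab.countOn_synthemeLine hS (h1.trans h2), lab.countOn_synthemeLine hS h2] at this
  omega

theorem inHexagon_of_mem_synthemeLine {b s : ℕ} (hb : b < 60) (hs : s < 15)
    (hbs : (hexagonPt h b : P) ∈ synthemeLine P h s) : InHexagon s b := by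
  obtain ⟨t, ht, htb, heq⟩ := lab.inHexagon_of_mem hS hb (lab.countOn_synthemeLine hS hs).ge hbs
  rwa [← lab.synthemeLine_inj hS ht hs heq]

theorem hexagonPt_inj {b c : ℕ} (hb : b < 60) (hc : c < 60)
    (hbc : (hexagonPt h b : P) = hexagonPt h c) : b = c := by
  obtain ⟨h1, h2⟩ := hexagon_lt b hb
  refine hexagon_ext b hb c hc (lab.inHexagon_of_mem_synthemeLine hS hc (h1.trans h2) ?_)
    (lab.inHexagon_of_mem_synthemeLine hS hc h2 ?_)
  · rw [← hbc]; exact lab.hexagonPt_mem hS hb (Or.inl rfl)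
  · rw [← hbc]; exact lab.hexagonPt_mem hS hb (Or.inr rfl)

theorem duadPt_ne_hexagonPt {d b : ℕ} (hd : d < 15) (hb : b < 60) :
    (duadPt h d : P) ≠ hexagonPt h b := fun h0 =>
  lab.hexagonPt_notMem hS hb (h0 ▸ lab.duadPt_mem_support hS hd)

theorem eq_of_countOn_eq_one {l : L} (hl : countOn S l = 1) {d e : ℕ} (hd : d < 15) (he : e < 15)
    (hdl : (duadPt h d : P) ∈ l) (hel : (duadPt h e : P) ∈ l) : d = e := by
  by_contra hne
  have := lab.card_le_countOn hS (l := l) (D := {d, e}) (by simp [hd, he, hdl, hel])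
  rw [Finset.card_pair hne] at this
  omega

theorem ne_synthemeLine {l : L} (hl : countOn S l = 1) {s : ℕ} (hs : s < 15) :
    l ≠ synthemeLine P h s := by
  rintro rfl
  rw [lab.countOn_synthemeLine hS hs] at hl
  omega

theorem not_inSyntheme_of_mem {l : L} (hl : countOn S l = 1) {d b s : ℕ} (hd : d < 15)
    (hb : b < 60) (hdl : (duadPt h d : P) ∈ l) (hbl : (hexagonPt h b : P) ∈ l)
    (hsb : InHexagon s b) : ¬ InSyntheme d s := by
  intro hds
  have hs : s < 15 := by
    have := hexagon_lt b hb
    rcases hsb with rfl | rfl <;> omega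
  exact lab.ne_synthemeLine hS hl hs (eq_of_mem (lab.duadPt_ne_hexagonPt hS hd hb) hdl hbl
    (lab.synthemeLine_mem hS hd hs hds) (lab.hexagonPt_mem hS hb hsb))

/-- The intersection with the syntheme line is off `S`. If all ten other lines there had one point
of `S`, the total would be 13 and not 15. So another line has at least three, by `off_two` exactly
three; it is a syntheme line, and its syntheme shares no duad with `s`, since the two lines meet off
`S`. -/
theorem exists_hexagonPt_mem {l : L} (hl : countOn S l = 1) {d s : ℕ} (hd : d < 15)
    (hdl : (duadPt h d : P) ∈ l) (hs : s < 15) (hds : ¬ InSyntheme d s) :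
    ∃ b ∈ hexagonsOn P h l, InHexagon s b := by
  have hne := lab.ne_synthemeLine hS hl hs
  obtain ⟨hql, hqs⟩ := meetPt_mem (P := P) hne
  set q : P := meetPt l (synthemeLine P h s) with hq
  have hqS : q ∉ S := by
    intro hqS
    obtain ⟨e, he, heq⟩ := lab.exists_duadPt hS hqS
    rw [← heq] at hql hqs
    have := lab.eq_of_countOn_eq_one hS hl hd he hdl hql
    subst this
    exact hds (lab.inSyntheme_of_mem hS hd hs hqs)
  obtain ⟨m, hqm, hms, hm⟩ : ∃ m : L, q ∈ m ∧ m ≠ synthemeLine P h s ∧ 3 ≤ countOn S m := by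
    by_contra! hcon
    have hsum := hS.sum_off (L := L) hqS
    rw [← Finset.add_sum_erase _ _ (show synthemeLine P h s ∈ Finset.univ.filter
      (fun l : L => q ∈ l) by simp [hqs]), lab.countOn_synthemeLine hS hs,
      Finset.sum_congr rfl (g := fun _ => 1) fun m hm => ?_, Finset.sum_const,
      Finset.card_erase_of_mem (by simp [hqs]), card_lines_through, hS.order_eq] at hsum
    · norm_num at hsum
    · rw [Finset.mem_erase, Finset.mem_filter] at hm
      have := hcon m hm.2.2 hm.1
      rcases hS.cases_countOn m with h0 | h0 | h0 <;> omega
  have hm3 : countOn S m = 3 := by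
    have h1 := hS.off_two hqS hms hqm hqs
    rw [lab.countOn_synthemeLine hS hs] at h1
    omega
  obtain ⟨t, ht, rfl⟩ := lab.exists_synthemeLine hS hm3
  have hst : ∀ e < 15, InSyntheme e s → ¬ InSyntheme e t := by
    intro e he h1 h2
    refine hms (eq_of_mem (fun h0 => hqS ?_) (lab.synthemeLine_mem hS he ht h2) hqm
      (lab.synthemeLine_mem hS he hs h1) hqs)
    exact h0 ▸ lab.duadPt_mem_support hS he
  obtain ⟨b, hb, hsb, htb⟩ := exists_hexagon s hs t ht hst
  have hbq : hexagonPt h b = q := point_eq_of_mem hms (lab.hexagonPt_mem hS hb htb) hqm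
    (lab.hexagonPt_mem hS hb hsb) hqs
  exact ⟨b, mem_hexagonsOn.2 ⟨hb, hbq ▸ hql⟩, hsb⟩

end

variable (S) in
/-- The hexagon masks of the lines that meet `S` in a single point, which is labelled `d`. -/
def simpleMasks (h : ℕ → L) (d : ℕ) : Set ℕ :=
  {x | ∃ l : L, countOn S l = 1 ∧ (duadPt h d : P) ∈ l ∧ x = mask (hexagonsOn P h l)}

include lab hS in
theorem system_simpleMasks : System (simpleMasks S h) where
  mem_lines := by
    rintro d hd x ⟨l, hl, hdl, rfl⟩
    refine mask_mem_lines hd (fun b hb => (mem_hexagonsOn.1 hb).1) (fun b hb s hs => ?_)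
      (fun s hs hds => lab.exists_hexagonPt_mem hS hl hd hdl hs hds) fun s b hb c hc hsb hsc => ?_
    · rw [mem_hexagonsOn] at hb
      exact lab.not_inSyntheme_of_mem hS hl hd hb.1 hdl hb.2 hs
    · rw [mem_hexagonsOn] at hb hc
      have hs : s < 15 := by
        have := hexagon_lt b hb.1
        rcases hsb with rfl | rfl <;> omega
      exact lab.hexagonPt_inj hS hb.1 hc.1 (point_eq_of_mem (lab.ne_synthemeLine hS hl hs) hb.2 hc.2
        (lab.hexagonPt_mem hS hb.1 hsb) (lab.hexagonPt_mem hS hc.1 hsc))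
  lt := by
    rintro d hd x ⟨l, hl, hdl, rfl⟩
    exact mask_lt fun b hb => (mem_hexagonsOn.1 hb).1
  ne_zero := by
    rintro d hd x ⟨l, hl, hdl, rfl⟩
    obtain ⟨s, hs, hds⟩ := exists_not_inSyntheme d hd
    obtain ⟨b, hb, -⟩ := lab.exists_hexagonPt_mem hS hl hd hdl hs hds
    rw [Ne, mask_eq_zero]
    exact Finset.ne_empty_of_mem hb
  exists_mem := by
    intro d hd b hbit
    have hb := lt_of_testBit (hexFree_bounds d hd).2 hbit
    obtain ⟨h1, h2⟩ := (hexFree_spec d hd b hb).1 hbit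
    obtain ⟨hlt1, hlt2⟩ := hexagon_lt b hb
    obtain ⟨hdl, hbl⟩ := joinLine_mem (L := L) (lab.duadPt_ne_hexagonPt hS hd hb)
    refine ⟨_, ⟨_, ?_, hdl, rfl⟩, (testBit_mask _ _).2 (mem_hexagonsOn.2 ⟨hb, hbl⟩)⟩
    by_contra hcon
    -- A joining line with three or more points would be one of the syntheme lines of `b`, and
    -- neither contains `d`.
    obtain ⟨s, hs, hsb, heq⟩ := lab.inHexagon_of_mem hS hb
      (by rcases hS.cases_countOn (joinLine (duadPt h d : P) (hexagonPt h b) : L) with h0 | h0 | h0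
            <;> omega) hbl
    rw [← heq] at hdl
    have := lab.inSyntheme_of_mem hS hd hs hdl
    rcases hsb with rfl | rfl
    exacts [h1 this, h2 this]
  disjoint := by
    rintro d hd x ⟨l, hl, hdl, rfl⟩ y ⟨m, hm, hdm, rfl⟩ hne
    rw [mask_land, mask_eq_zero]
    refine Finset.eq_empty_of_forall_notMem fun b hb => hne ?_
    rw [Finset.mem_inter, mem_hexagonsOn, mem_hexagonsOn] at hb
    rw [eq_of_mem (lab.duadPt_ne_hexagonPt hS hd hb.1.1) hdl hb.1.2 hdm hb.2.2]
  sparse := by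
    rintro d hd e he hde x ⟨l, hl, hdl, rfl⟩ y ⟨m, hm, hem, rfl⟩
    have hlm : l ≠ m := by
      rintro rfl
      exact hde (lab.eq_of_countOn_eq_one hS hl hd he hdl hem)
    rw [mask_land]
    refine lowErase_mask_eq_zero (Finset.card_le_one.2 fun b hb c hc => ?_)
    rw [Finset.mem_inter, mem_hexagonsOn, mem_hexagonsOn] at hb hc
    exact lab.hexagonPt_inj hS hb.1.1 hc.1.1 (point_eq_of_mem hlm hb.1.2 hc.1.2 hb.2.2 hc.2.2)

variable {k : ℕ}

include lab hS

theorem synthemeLine_comp_adj (hk : k < 5) {s : ℕ} (hs : s < 15) :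
    synthemeLine P (h ∘ adj k) s = synthemeLine P h (synthemeImage k s) := by
  have lab' := lab.comp_adj hk
  obtain ⟨ha, hb, has, hbs⟩ := synthemePair_spec s hs
  obtain ⟨hs', himage⟩ := inSyntheme_image k hk s hs
  have hne : (synthemePair s).1 ≠ (synthemePair s).2 := by
    intro h0
    have hlt := duad_lt _ ha
    have := (synthemePair_disjoint s hs).1
    rw [← h0] at this
    exact this _ (hlt.1.trans hlt.2) (Or.inl rfl) (Or.inl rfl)
  refine lab'.synthemeLine_eq hS ha hb hs hne has hbs ?_ ?_
  · rw [duadPt_comp_adj hk h ha]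
    exact lab.synthemeLine_mem hS (duadImage_spec k hk _ ha).1 hs' (himage _ ha has)
  · rw [duadPt_comp_adj hk h hb]
    exact lab.synthemeLine_mem hS (duadImage_spec k hk _ hb).1 hs' (himage _ hb hbs)

theorem hexagonPt_comp_adj (hk : k < 5) {b : ℕ} (hb : b < 60) :
    (hexagonPt (h ∘ adj k) b : P) = hexagonPt h (hexImage k b) := by
  obtain ⟨h1, h2⟩ := hexagon_lt b hb
  unfold hexagonPt
  rw [lab.synthemeLine_comp_adj hS hk (h1.trans h2), lab.synthemeLine_comp_adj hS hk h2]
  rcases hexagon_hexImage k hk b hb with h0 | h0 <;> rw [h0]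
  rw [meetPt_comm]

theorem hexagonsOn_comp_adj (hk : k < 5) (l : L) :
    hexagonsOn P (h ∘ adj k) l = (hexagonsOn P h l).image (hexImage k) := by
  ext b
  rw [Finset.mem_image, mem_hexagonsOn]
  constructor
  · rintro ⟨hb, hbl⟩
    obtain ⟨h1, h2, -⟩ := hexImage_spec k hk b hb
    rw [lab.hexagonPt_comp_adj hS hk hb] at hbl
    exact ⟨_, mem_hexagonsOn.2 ⟨h1, hbl⟩, h2⟩
  · rintro ⟨c, hc, rfl⟩
    rw [mem_hexagonsOn] at hc
    obtain ⟨h1, h2, -⟩ := hexImage_spec k hk c hc.1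
    refine ⟨h1, ?_⟩
    rw [lab.hexagonPt_comp_adj hS hk h1, h2]
    exact hc.2

end Labelling

theorem OddSet.stableClass (hS : OddSet L S) :
    StableClass {X | ∃ h : ℕ → L, Labelling S h ∧ X = Labelling.simpleMasks S h} where
  system := by
    rintro X ⟨h, lab, rfl⟩
    exact lab.system_simpleMasks hS
  stable := by
    rintro X ⟨h, lab, rfl⟩ k hk
    refine ⟨_, ⟨h ∘ adj k, lab.comp_adj hk, rfl⟩, ?_⟩
    rintro d hd x ⟨l, hl, hdl, rfl⟩
    obtain ⟨h1, h2⟩ := duadImage_spec k hk d hd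
    rw [act_mask hk d fun b hb => (mem_hexagonsOn.1 hb).1]
    refine ⟨l, hl, ?_, by rw [lab.hexagonsOn_comp_adj hS hk]⟩
    rwa [duadPt_comp_adj hk h h1, h2]

/-- The hexagons 25 and 31 have no syntheme in common, so the line joining their points is neither a
syntheme line nor heavy. It is thus simple, and `StableClass.not_both` forbids it. -/
theorem not_oddSet (hS : OddSet L S) : False := by
  obtain ⟨h, lab⟩ := hS.exists_labelling
  have hne : (hexagonPt h 25 : P) ≠ hexagonPt h 31 := fun h0 => by
    have := lab.hexagonPt_inj hS (by norm_num) (by norm_num) h0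
    omega
  obtain ⟨h1, h2⟩ := joinLine_mem (L := L) hne
  set l : L := joinLine (hexagonPt h 25 : P) (hexagonPt h 31)
  have hl : countOn S l = 1 := by
    by_contra hcon
    have h3 : 3 ≤ countOn S l := by rcases hS.cases_countOn l with h0 | h0 | h0 <;> omega
    obtain ⟨s, hs, hs25, hsl⟩ := lab.inHexagon_of_mem hS (by norm_num) h3 h1
    rw [← hsl] at h2
    exact hexagons_25_31 s hs hs25 (lab.inHexagon_of_mem_synthemeLine hS (by norm_num) hs h2)
  obtain ⟨p, hp⟩ : (S.filter (· ∈ l)).Nonempty := by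
    rw [← Finset.card_pos]
    exact hS.pos l
  rw [Finset.mem_filter] at hp
  obtain ⟨d, hd, rfl⟩ := lab.exists_duadPt hS hp.1
  exact hS.stableClass.not_both ⟨h, lab, rfl⟩ hd ⟨l, hl, hp.2, rfl⟩
    (mem_hexagonsOn.2 ⟨by norm_num, h1⟩) (mem_hexagonsOn.2 ⟨by norm_num, h2⟩)

/-! ### The support of a word of weight fifteen -/

theorem sum_eq_card_support {ι : Type*} (T : Finset ι) (c : ι → ZMod 2) :
    ∑ p ∈ T, c p = ((T.filter fun p => c p ≠ 0).card : ZMod 2) := by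
  have h : ∀ x : ZMod 2, x = if x ≠ 0 then 1 else 0 := by decide
  rw [Finset.card_filter, Nat.cast_sum]
  refine Finset.sum_congr rfl fun p _ => ?_
  rw [Nat.cast_ite, Nat.cast_one, Nat.cast_zero]
  convert h (c p)

/-- Both sides are linear in `c`, so rows suffice. For a row both are 1 modulo 2: two lines share 1
or 11 points, and a line has 11 points. -/
theorem sum_on_line_eq (horder : order P L = 10) {c : P → ZMod 2} (hc : c ∈ code P L) (l : L) :
    ∑ p ∈ Finset.univ.filter (fun p => p ∈ l), c p = ∑ p, c p := by
  induction hc using Submodule.span_induction with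
  | mem x hx =>
    obtain ⟨m, rfl⟩ := hx
    have hrow : ∀ p, (incidenceMatrix P L).row m p = if p ∈ m then 1 else 0 := fun p => rfl
    have h11 : ∀ l : L, ((Finset.univ.filter fun p : P => p ∈ l).card : ZMod 2) = 1 := by
      intro l
      rw [card_points_on, horder]
      rfl
    simp only [hrow]
    rw [Finset.sum_boole, Finset.sum_boole, h11, Finset.filter_filter]
    rcases eq_or_ne l m with rfl | hlm
    · simp only [and_self]
      exact h11 l
    · obtain ⟨h1, h2⟩ := meetPt_mem (P := P) hlm
      have : (Finset.univ.filter fun p : P => p ∈ l ∧ p ∈ m) = {meetPt l m} := by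
        ext p
        simp only [Finset.mem_filter, Finset.mem_univ, true_and, Finset.mem_singleton]
        exact ⟨fun hp => point_eq_of_mem hlm hp.1 h1 hp.2 h2, by rintro rfl; exact ⟨h1, h2⟩⟩
      rw [this]
      simp
  | zero => simp
  | add x y _ _ hx hy => simp only [Pi.add_apply, Finset.sum_add_distrib, hx, hy]
  | smul a x _ hx => simp only [Pi.smul_apply, ← Finset.smul_sum, hx]

theorem oddSet_support (horder : order P L = 10) {c : P → ZMod 2} (hc : c ∈ code P L)
    (h15 : hammingNorm c = 15) : OddSet L (Finset.univ.filter fun p => c p ≠ 0) where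
  order_eq := horder
  card_eq := by
    rw [← h15, hammingNorm]
  odd l := by
    have hcard : (Finset.univ.filter fun p => c p ≠ 0).card = 15 := by
      rw [← h15, hammingNorm]
    have h := sum_on_line_eq horder hc l
    rw [sum_eq_card_support, sum_eq_card_support, hcard, Finset.filter_filter] at h
    rw [← ZMod.natCast_eq_one_iff_odd, countOn, Finset.filter_filter]
    simp only [and_comm] at h ⊢
    exact h

end Simple
end PlaneCode

theorem mainTheorem1 {P L : Type*} [Membership P L] [Fintype P] [Finite L]
    [Configuration.ProjectivePlane P L]
    (horder : Configuration.ProjectivePlane.order P L = 10) :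
    ∀ c ∈ PlaneCode.code P L, hammingNorm c ≠ 15 := by
  intro c hc h15
  cases nonempty_fintype L
  exact PlaneCode.not_oddSet (PlaneCode.oddSet_support horder hc h15)
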